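/- Fix an integer $p\ge 2$. For $N\ge 1$ and $\beta\ge 0$ let $\mathbb P_\beta$ be the $p$-spin Curie–Weiss model on $\{-1,1\}^N$, $$\mathbb P_\beta(x)=\frac{e^{\beta H_N(x)}}{2^N Z_N(\beta)},\qquad H_N(x)=\sum_{1\le i_1,\dots,i_p\le N}J_{i_1\dots i_p}x_{i_1}\cdots x_{i_p},\qquad J_{i_1\dots i_p}=\frac1{N^{p-1}}\ \text{ for all } i_1,\dots,i_p,$$ where $Z_N(\beta)=2^{-N}\sum_{x\in\{-1,1\}^N} e^{\beta H_N(x)}$. Let $m_i(x)=\sum_{i_2,\dots,i_p}J_{i i_2\dots i_p}x_{i_2}\cdots x_{i_p}$, and let $$\hat\beta_N(x)=\inf\Big\{b\ge 0:\ H_N(x)=\sum_{i=1}^N m_i(x)\tanh\big(p\,b\,m_i(x)\big)\Big\}\in[0,\infty]\qquad(\inf\emptyset=+\infty)$$ be the maximum pseudo-likelihood (MPL) estimate. Put $I(t)=\frac12\{(1+t)\log(1+t)+(1-t)\log(1-t)\}$ for $t\in[-1,1]$ (with $0\log 0=0$), $g(t)=\beta t^p-I(t)$ for $t\in[-1,1]$,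 and $$\beta^*_{\mathrm{CW}}(p)=\sup\Big\{\beta\ge 0:\ \sup_{t\in[0,1]}\{\beta t^p-I(t)\}=0\Big\}.$$ Let $\beta>\beta^*_{\mathrm{CW}}(p)$. Then $g$ has exactly one global maximizer $m_*$ over $[-1,1]$ that is positive; it satisfies $m_*<1$ and $g''(m_*)<0$. If $X\sim\mathbb P_\beta$, then as $N\to\infty$ $$\sqrt N\big(\hat\beta_N(X)-\beta\big)\ \xrightarrow{D}\ N\Big(0,\ -\frac{g''(m_*)}{p^2m_*^{2p-2}}\Big),$$ as convergence in distribution of extended-real random variables. Moreover this variance is the inverse of the limiting Fisher information: as $N\to\infty$, $$\frac1N\,\mathbb E_\beta\Big[\Big(\frac{\mathrm d}{\mathrm d\beta}\log\mathbb P_\beta(X)\Big)^2\Big]\ \longrightarrow\ \Big(-\frac{g''(m_*)}{p^2m_*^{2p-2}}\Big)^{-1}.$$ -/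

import Mathlib

open Filter MeasureTheory ProbabilityTheory Set
open scoped Topology

namespace TensorIsing

/-- The configuration space `{-1, 1}^N`; `ℤˣ` is the two-element set `{1, -1}` of units of `ℤ`. -/
abbrev Config (N : ℕ) : Type := Fin N → ℤˣ

/-- The real value `±1` of the `i`-th coordinate. -/
def spin {N : ℕ} (x : Config N) (i : Fin N) : ℝ := ((x i : ℤ) : ℝ)

/-- A `p`-tensor (for `p ≥ 1`) on `[N]`, with the first index split off: the entry
`J_{i k_1 ... k_{p-1}}` is `J i k`. -/
abbrev Tensor (p N : ℕ) : Type := Fin N → (Fin (p - 1) → Fin N) → ℝ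

/-- The Curie-Weiss interaction tensor: all entries are `1 / N ^ (p - 1)`. -/
noncomputable def curieWeissTensor (p N : ℕ) : Tensor p N := fun _ _ => 1 / (N : ℝ) ^ (p - 1)

variable {p N : ℕ}

/-- The local field `m_i(x) = ∑_{i_2, ..., i_p} J_{i i_2 ... i_p} x_{i_2} ⋯ x_{i_p}`. -/
noncomputable def localField (J : Tensor p N) (x : Config N) (i : Fin N) : ℝ :=
  ∑ k : Fin (p - 1) → Fin N, J i k * ∏ j, spin x (k j)

/-- The Hamiltonian `H_N(x) = ∑_{i_1, ..., i_p} J_{i_1 ... i_p} x_{i_1} ⋯ x_{i_p}`. -/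
noncomputable def hamiltonian (J : Tensor p N) (x : Config N) : ℝ :=
  ∑ i : Fin N, ∑ k : Fin (p - 1) → Fin N, J i k * (spin x i * ∏ j, spin x (k j))

/-- The normalizing constant `Z_N(β) = 2^{-N} ∑_x exp (β H_N(x))`. -/
noncomputable def partitionFunction (J : Tensor p N) (β : ℝ) : ℝ :=
  1 / 2 ^ N * ∑ x : Config N, Real.exp (β * hamiltonian J x)

/-- The probability mass function of the Ising model,
`P_β(x) = exp (β H_N(x)) / (2^N Z_N(β))`. -/
noncomputable def massFunction (J : Tensor p N) (β : ℝ) (x : Config N) : ℝ :=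
  Real.exp (β * hamiltonian J x) / (2 ^ N * partitionFunction J β)

/-- The law `P_β` of the Ising model on `{-1, 1}^N`. -/
noncomputable def law (J : Tensor p N) (β : ℝ) : Measure (Config N) :=
  ∑ x : Config N, ENNReal.ofReal (massFunction J β x) • Measure.dirac x

lemma partitionFunction_pos (J : Tensor p N) (β : ℝ) : 0 < partitionFunction J β := by
  unfold partitionFunction
  have : 0 < ∑ x : Config N, Real.exp (β * hamiltonian J x) :=
    Finset.sum_pos (fun x _ => Real.exp_pos _) Finset.univ_nonempty
  positivity

lemma massFunction_nonneg (J : Tensor p N) (β : ℝ) (x : Config N) : 0 ≤ massFunction J β x := by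
  have := partitionFunction_pos J β
  unfold massFunction
  positivity

lemma sum_massFunction (J : Tensor p N) (β : ℝ) : ∑ x : Config N, massFunction J β x = 1 := by
  have h := partitionFunction_pos J β
  unfold massFunction
  rw [← Finset.sum_div, div_eq_one_iff_eq (by positivity)]
  unfold partitionFunction
  field_simp

instance law_isProbabilityMeasure (J : Tensor p N) (β : ℝ) : IsProbabilityMeasure (law J β) := by
  constructor
  simp only [law, Measure.coe_finsetSum, Finset.sum_apply, Measure.smul_apply, measure_univ,
    smul_eq_mul, mul_one]
  rw [← ENNReal.ofReal_sum_of_nonneg (fun x _ => massFunction_nonneg J β x), sum_massFunction,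
    ENNReal.ofReal_one]

/-- The maximum pseudo-likelihood estimate
`inf {b ≥ 0 : H_N(x) = ∑_i m_i(x) tanh (p b m_i(x))}`, with `inf ∅ = +∞`.
The equation says that the derivative in `b` of the concave log-pseudo-likelihood
`∑_i log P_b(x_i | (x_j)_{j ≠ i}) = ∑_i (p b x_i m_i(x) - log (2 cosh (p b m_i(x))))` vanishes. -/
noncomputable def mple (J : Tensor p N) (x : Config N) : EReal :=
  sInf ((fun b : ℝ => (b : EReal)) '' {b : ℝ | 0 ≤ b ∧
    hamiltonian J x = ∑ i, localField J x i * Real.tanh (p * b * localField J x i)})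

/-- The scaled Fisher information `(1 / N) E_β [(d/dβ log P_β(X))^2]`. -/
noncomputable def fisherInformation (J : Tensor p N) (β : ℝ) : ℝ :=
  1 / (N : ℝ) * ∫ x, (deriv (fun b => Real.log (massFunction J b x)) β) ^ 2 ∂(law J β)

/-- The binary entropy function `I`, for arguments in `[-1, 1]`
(with `0 log 0 = 0` at the endpoints). -/
noncomputable def entropy (t : ℝ) : ℝ :=
  1 / 2 * ((1 + t) * Real.log (1 + t) + (1 - t) * Real.log (1 - t))

/-- The function `g(t) = β t^p - I(t)`, for `t` in `[-1, 1]`. -/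
noncomputable def freeEnergy (p : ℕ) (β t : ℝ) : ℝ := β * t ^ p - entropy t

/-- The Curie-Weiss threshold
`sup {β ≥ 0 : sup_{t ∈ [0, 1]} (β t^p - I(t)) = 0}`. -/
noncomputable def threshold (p : ℕ) : ℝ :=
  sSup {β : ℝ | 0 ≤ β ∧ sSup (freeEnergy p β '' Icc 0 1) = 0}

end TensorIsing

namespace TensorIsing

/-! The model depends on a configuration only through its mean spin $t$: $H_N=Nt^p$ and every
$m_i=t^{p-1}$. For $t\in(0,1)$ the pseudo-likelihood equation therefore has the single root
$u(t)=\operatorname{artanh}t/(p\,t^{p-1})$ (`mpleOfMean_eq`). Since $g'(t)=p\beta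
t^{p-1}-\operatorname{artanh}t$, criticality of $m_*$ says exactly $u(m_*)=\beta$, so the
estimator's error is a delta-method image of $\sqrt N(t-m_*)$.

The analytic core is Laplace's method with observables, `IsPeak.tendsto_gibbsAverage`: near its
peaks $\sqrt N(t-m_*)$ is asymptotically $N(0,-1/g''(m_*))$, even when integrated against
observables of quadratic growth. Stirling turns the binomial weights into $e^{Ng}$ times a tame
prefactor; the sum over $k$ is written exactly as an integral of a step function, and dominated
convergence applies. Outside the windows the mass is exponentially small. For even $p$ there is a
second peak at $-m_*$, but the estimator and $H_N$ are even in $t$, so it only doubles numerator and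
denominator.

Nondegeneracy and uniqueness of $m_*$ come from the shape of $u$: $u'$ has the sign of `slope`,
which once nonnegative stays positive (`slope_pos_of_nonneg`). A critical point with $g>0$ must lie
where $u$ increases, and $u$ takes the value $\beta$ there only once.

With $s$ the value of `slope` at $m_*$, one has $g''(m_*)=-s/m_*$ and $u'(m_*)=s/(p\,m_*^p)$, so
$u'(m_*)^2/(-g''(m_*))$ is the stated variance. The Fisher information is
$N^{-1}\operatorname{Var}H_N=N\operatorname{Var}(t^p)\to(p\,m_*^{p-1})^2/(-g''(m_*))$, its inverse.
-/

/-! ### Entropy, free energy and the threshold -/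

lemma artanh_eq_sub_log {t : ℝ} (ht : t ∈ Ioo (-1 : ℝ) 1) :
    Real.artanh t = (Real.log (1 + t) - Real.log (1 - t)) / 2 := by
  rw [Real.artanh_eq_half_log (Ioo_subset_Icc_self ht),
    Real.log_div (by linarith [ht.1]) (by linarith [ht.2])]
  ring

lemma hasDerivAt_artanh {t : ℝ} (ht : t ∈ Ioo (-1 : ℝ) 1) :
    HasDerivAt Real.artanh (1 / (1 - t ^ 2)) t := by
  have h1 : 1 + t ≠ 0 := by linarith [ht.1]
  have h2 : 1 - t ≠ 0 := by linarith [ht.2]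
  have h3 : 1 - t ^ 2 ≠ 0 := by
    have : 1 - t ^ 2 = (1 + t) * (1 - t) := by ring
    rw [this]; exact mul_ne_zero h1 h2
  have hd : HasDerivAt (fun t : ℝ => (Real.log (1 + t) - Real.log (1 - t)) / 2)
      ((1 / (1 + t) - (-1) / (1 - t)) / 2) t :=
    ((((hasDerivAt_id t).const_add 1).log h1).sub
      (((hasDerivAt_id t).const_sub 1).log h2)).div_const 2
  have hd' := hd.congr_of_eventuallyEq (f₁ := Real.artanh) (by
    filter_upwards [isOpen_Ioo.mem_nhds ht] with s hs using artanh_eq_sub_log hs)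
  refine HasDerivAt.congr_deriv hd' ?_
  field_simp
  ring

lemma continuous_entropy : Continuous entropy := by
  unfold entropy
  have h1 : Continuous fun t : ℝ => (1 + t) * Real.log (1 + t) :=
    Real.continuous_mul_log.comp (continuous_const.add continuous_id)
  have h2 : Continuous fun t : ℝ => (1 - t) * Real.log (1 - t) :=
    Real.continuous_mul_log.comp (continuous_const.sub continuous_id)
  exact continuous_const.mul (h1.add h2)

lemma continuous_freeEnergy (p : ℕ) (β : ℝ) : Continuous (freeEnergy p β) :=
  (continuous_const.mul (continuous_pow p)).sub continuous_entropy

lemma entropy_neg (t : ℝ) : entropy (-t) = entropy t := by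
  unfold entropy
  rw [sub_neg_eq_add, ← sub_eq_add_neg]
  ring

lemma entropy_zero : entropy 0 = 0 := by simp [entropy]

lemma entropy_one : entropy 1 = Real.log 2 := by
  unfold entropy
  norm_num
  ring

lemma hasDerivAt_entropy {t : ℝ} (ht : t ∈ Ioo (-1 : ℝ) 1) :
    HasDerivAt entropy (Real.artanh t) t := by
  have h1 : 1 + t ≠ 0 := by linarith [ht.1]
  have h2 : 1 - t ≠ 0 := by linarith [ht.2]
  have e1 := ((hasDerivAt_id t).const_add 1).mul (((hasDerivAt_id t).const_add 1).log h1)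
  have e2 := ((hasDerivAt_id t).const_sub 1).mul (((hasDerivAt_id t).const_sub 1).log h2)
  have := (e1.add e2).const_mul (1 / 2)
  rw [artanh_eq_sub_log ht]
  refine HasDerivAt.congr_deriv this ?_
  simp only [id]
  field_simp
  ring

lemma hasDerivAt_freeEnergy (p : ℕ) (β : ℝ) {t : ℝ} (ht : t ∈ Ioo (-1 : ℝ) 1) :
    HasDerivAt (freeEnergy p β) (p * β * t ^ (p - 1) - Real.artanh t) t := by
  have := ((hasDerivAt_pow p t).const_mul β).sub (hasDerivAt_entropy ht)
  refine HasDerivAt.congr_deriv this ?_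
  ring

lemma entropy_pos {t : ℝ} (h0 : 0 < t) (h1 : t ≤ 1) : 0 < entropy t := by
  have : StrictMonoOn entropy (Icc 0 1) := by
    refine strictMonoOn_of_deriv_pos (convex_Icc 0 1) continuous_entropy.continuousOn ?_
    intro x hx
    rw [interior_Icc] at hx
    rw [(hasDerivAt_entropy ⟨by linarith [hx.1], hx.2⟩).deriv]
    exact Real.artanh_pos hx
  have h := this (a := 0) (b := t) ⟨le_rfl, zero_le_one⟩ ⟨h0.le, h1⟩ h0
  rwa [entropy_zero] at h

lemma entropy_nonneg {t : ℝ} (ht : t ∈ Icc (-1 : ℝ) 1) : 0 ≤ entropy t := by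
  rcases lt_trichotomy t 0 with h | h | h
  · rw [← entropy_neg]
    exact (entropy_pos (by linarith) (by linarith [ht.1])).le
  · rw [h, entropy_zero]
  · exact (entropy_pos h ht.2).le

lemma freeEnergy_zero {p : ℕ} (hp : 2 ≤ p) (β : ℝ) : freeEnergy p β 0 = 0 := by
  unfold freeEnergy
  rw [entropy_zero, zero_pow (by omega)]
  ring

lemma freeEnergy_neg {p : ℕ} (hp : Even p) (β t : ℝ) : freeEnergy p β (-t) = freeEnergy p β t := by
  unfold freeEnergy
  rw [entropy_neg, hp.neg_pow]

lemma freeEnergy_nonpos_of_odd {p : ℕ} (hp : ¬ Even p) {β t : ℝ} (hβ : 0 ≤ β)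
    (ht : t ∈ Icc (-1 : ℝ) 1) (ht0 : t ≤ 0) : freeEnergy p β t ≤ 0 := by
  have h := entropy_nonneg ht
  have h2 : t ^ p ≤ 0 := (Nat.not_even_iff_odd.mp hp).pow_nonpos ht0
  unfold freeEnergy
  nlinarith [mul_nonneg hβ (neg_nonneg.mpr h2)]

lemma pos_of_threshold_lt {p : ℕ} {β : ℝ} (hβ : threshold p < β) : 0 < β := by
  refine lt_of_le_of_lt ?_ hβ
  refine Real.sSup_nonneg fun x hx => hx.1

/-- Otherwise $g\le 0=g(0)$ on $[0,1]$, which puts $\beta$ in the set whose supremum is the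
threshold. -/
lemma exists_freeEnergy_pos {p : ℕ} (hp : 2 ≤ p) {β : ℝ} (hβ : threshold p < β) :
    ∃ t ∈ Icc (0 : ℝ) 1, 0 < freeEnergy p β t := by
  have hβ0 := pos_of_threshold_lt hβ
  by_contra! hcon
  have hmem : β ∈ {β : ℝ | 0 ≤ β ∧ sSup (freeEnergy p β '' Icc 0 1) = 0} := by
    refine ⟨hβ0.le, IsGreatest.csSup_eq ⟨⟨0, ⟨le_rfl, zero_le_one⟩, freeEnergy_zero hp β⟩, ?_⟩⟩
    rintro _ ⟨t, ht, rfl⟩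
    exact hcon t ht
  have hbdd : BddAbove {β : ℝ | 0 ≤ β ∧ sSup (freeEnergy p β '' Icc 0 1) = 0} := by
    -- Evaluating at $t=1$ gives $b-\log 2\le 0$. Boundedness is essential, since a real `sSup` of
    -- an unbounded set is $0$.
    refine ⟨Real.log 2, ?_⟩
    rintro b ⟨-, hb⟩
    have h1 : freeEnergy p b 1 ≤ sSup (freeEnergy p b '' Icc 0 1) :=
      le_csSup ((isCompact_Icc.image (continuous_freeEnergy p b)).bddAbove)
        ⟨1, ⟨zero_le_one, le_rfl⟩, rfl⟩
    rw [hb] at h1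
    unfold freeEnergy at h1
    rw [entropy_one, one_pow] at h1
    linarith
  exact absurd (le_csSup hbdd hmem) (not_le.mpr hβ)

/-! ### Shape of `artanh t / t ^ (p - 1)` and critical points -/

/-- The numerator of the derivative of `artanh t / t ^ (p - 1)`; at a critical point `m` of
`freeEnergy p β` it equals `-m` times the second derivative. -/
noncomputable def slope (p : ℕ) (t : ℝ) : ℝ := t / (1 - t ^ 2) - (p - 1) * Real.artanh t

lemma one_sub_sq_pos {t : ℝ} (ht : t ∈ Ioo (-1 : ℝ) 1) : 0 < 1 - t ^ 2 := by
  nlinarith [ht.1, ht.2]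

lemma hasDerivAt_slope (p : ℕ) {t : ℝ} (ht : t ∈ Ioo (-1 : ℝ) 1) :
    HasDerivAt (slope p) ((p * t ^ 2 - (p - 2)) / (1 - t ^ 2) ^ 2) t := by
  have h := (one_sub_sq_pos ht).ne'
  have h1 := ((hasDerivAt_id t).div ((hasDerivAt_pow 2 t).const_sub 1) h).sub
    ((hasDerivAt_artanh ht).const_mul ((p : ℝ) - 1))
  refine HasDerivAt.congr_deriv h1 ?_
  simp only [id]
  field_simp
  push_cast
  ring

lemma slope_zero (p : ℕ) : slope p 0 = 0 := by simp [slope]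

/-- The derivative of `slope` has the sign of $pt^2-(p-2)$, which increases with $t>0$; as `slope`
starts at $0$, it can become nonnegative only after this sign has turned, and increases from then
on. -/
lemma slope_pos_of_nonneg {p : ℕ} (hp : 0 < p) {s t : ℝ} (hs : 0 < s) (hst : s < t) (ht : t < 1)
    (h : 0 ≤ slope p s) : 0 < slope p t := by
  -- The mean value theorem on $[0,s]$ supplies a point $c<s$ where the derivative is already
  -- nonnegative.
  obtain ⟨c, hc, hc'⟩ := exists_hasDerivAt_eq_slope (slope p)
    (fun t => (p * t ^ 2 - (p - 2)) / (1 - t ^ 2) ^ 2) hs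
    (fun x hx => (hasDerivAt_slope p
      ⟨by linarith [hx.1], by linarith [hx.2]⟩).continuousAt.continuousWithinAt)
    (fun x hx => hasDerivAt_slope p ⟨by linarith [hx.1], by linarith [hx.2]⟩)
  have hc1 : 0 < 1 - c ^ 2 := one_sub_sq_pos ⟨by linarith [hc.1], by linarith [hc.2]⟩
  have hc2 : 0 ≤ (p : ℝ) * c ^ 2 - (p - 2) := by
    by_contra hneg
    push Not at hneg
    have h1 : ((p : ℝ) * c ^ 2 - (p - 2)) / (1 - c ^ 2) ^ 2 < 0 :=
      div_neg_of_neg_of_pos hneg (by positivity)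
    have h2 : 0 ≤ (slope p s - slope p 0) / (s - 0) := by
      rw [slope_zero, sub_zero, sub_zero]; positivity
    linarith [hc']
  have hmono : StrictMonoOn (slope p) (Icc s t) := by
    refine strictMonoOn_of_deriv_pos (convex_Icc s t)
      (fun x hx => (hasDerivAt_slope p
        ⟨by linarith [hx.1], by linarith [hx.2]⟩).continuousAt.continuousWithinAt) ?_
    intro x hx
    rw [interior_Icc] at hx
    have hx1 : x ∈ Ioo (-1 : ℝ) 1 := ⟨by linarith [hx.1], by linarith [hx.2]⟩
    rw [(hasDerivAt_slope p hx1).deriv]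
    have hx2 := one_sub_sq_pos hx1
    have : c ^ 2 < x ^ 2 := by nlinarith [hc.1, hc.2, hx.1]
    have hp' : (0 : ℝ) < p := by exact_mod_cast hp
    refine div_pos ?_ (by positivity)
    nlinarith
  exact lt_of_le_of_lt h (hmono (left_mem_Icc.mpr hst.le) (right_mem_Icc.mpr hst.le) hst)

lemma hasDerivAt_artanh_div_pow {p : ℕ} (hp : 2 ≤ p) {t : ℝ} (ht : t ∈ Ioo (0 : ℝ) 1) :
    HasDerivAt (fun t => Real.artanh t / t ^ (p - 1)) (slope p t / t ^ p) t := by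
  have ht0 : t ≠ 0 := ht.1.ne'
  have ht' : t ∈ Ioo (-1 : ℝ) 1 := ⟨by linarith [ht.1], ht.2⟩
  have h := (one_sub_sq_pos ht').ne'
  have h1 := (hasDerivAt_artanh ht').div (hasDerivAt_pow (p - 1) t) (pow_ne_zero _ ht0)
  obtain ⟨q, rfl⟩ := Nat.exists_eq_add_of_le' hp
  refine HasDerivAt.congr_deriv h1 ?_
  unfold slope
  rw [show q + 2 - 1 = q + 1 by omega, show q + 1 - 1 = q by omega]
  push_cast
  field_simp
  ring

lemma strictAntiOn_artanh_div_pow {p : ℕ} (hp : 2 ≤ p) {m : ℝ} (h1 : m < 1)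
    (hm : slope p m ≤ 0) : StrictAntiOn (fun t => Real.artanh t / t ^ (p - 1)) (Ioc 0 m) := by
  refine strictAntiOn_of_deriv_neg (convex_Ioc 0 m)
    (fun x hx => (hasDerivAt_artanh_div_pow hp
      ⟨hx.1, lt_of_le_of_lt hx.2 h1⟩).continuousAt.continuousWithinAt) ?_
  intro x hx
  rw [interior_Ioc] at hx
  rw [(hasDerivAt_artanh_div_pow hp ⟨hx.1, hx.2.trans h1⟩).deriv]
  refine div_neg_of_neg_of_pos ?_ (pow_pos hx.1 p)
  by_contra! hcon
  exact absurd (slope_pos_of_nonneg (by omega) hx.1 hx.2 h1 hcon) (not_lt.mpr hm)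

/-- If `slope` were nonpositive at $m$, then $\operatorname{artanh}t/t^{p-1}$ would exceed its value
$p\beta$ at $m$ throughout $(0,m)$, that is $g'<0$ there, forcing $g(m)<g(0)=0$. -/
lemma slope_pos_of_critical {p : ℕ} (hp : 2 ≤ p) {β m : ℝ} (h0 : 0 < m) (h1 : m < 1)
    (hcrit : p * β * m ^ (p - 1) = Real.artanh m) (hm : 0 < freeEnergy p β m) :
    0 < slope p m := by
  by_contra! hcon
  have hanti := strictAntiOn_artanh_div_pow hp h1 hcon
  have : StrictAntiOn (freeEnergy p β) (Icc 0 m) := by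
    refine strictAntiOn_of_deriv_neg (convex_Icc 0 m) (continuous_freeEnergy p β).continuousOn ?_
    intro x hx
    rw [interior_Icc] at hx
    rw [(hasDerivAt_freeEnergy p β ⟨by linarith [hx.1], by linarith [hx.2]⟩).deriv]
    have := hanti ⟨hx.1, hx.2.le⟩ ⟨h0, le_rfl⟩ hx.2
    simp only [← hcrit] at this
    have hmp : m ^ (p - 1) ≠ 0 := (pow_pos h0 _).ne'
    rw [mul_div_assoc, div_self hmp, mul_one, lt_div_iff₀ (pow_pos hx.1 _)] at this
    linarith
  have h := this (left_mem_Icc.mpr h0.le) (right_mem_Icc.mpr h0.le) h0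
  rw [freeEnergy_zero hp] at h
  linarith

/-- Past $m$ the function $\operatorname{artanh}t/t^{p-1}$ is strictly increasing, yet it equals
$p\beta$ at both critical points. -/
lemma critical_unique {p : ℕ} (hp : 2 ≤ p) {β m t : ℝ} (h0 : 0 < m) (hmt : m < t) (h1 : t < 1)
    (hm : p * β * m ^ (p - 1) = Real.artanh m) (ht : p * β * t ^ (p - 1) = Real.artanh t)
    (hs : 0 < slope p m) : False := by
  have hmono : StrictMonoOn (fun t => Real.artanh t / t ^ (p - 1)) (Icc m t) := by
    refine strictMonoOn_of_deriv_pos (convex_Icc m t)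
      (fun x hx => (hasDerivAt_artanh_div_pow hp
        ⟨by linarith [hx.1], by linarith [hx.2]⟩).continuousAt.continuousWithinAt) ?_
    intro x hx
    rw [interior_Icc] at hx
    have hx0 : 0 < x := h0.trans hx.1
    rw [(hasDerivAt_artanh_div_pow hp ⟨hx0, hx.2.trans h1⟩).deriv]
    exact div_pos (slope_pos_of_nonneg (by omega) h0 hx.1 (hx.2.trans h1) hs.le) (pow_pos hx0 p)
  have := hmono (left_mem_Icc.mpr hmt.le) (right_mem_Icc.mpr hmt.le) hmt
  simp only [← hm, ← ht] at this
  rw [mul_div_assoc, mul_div_assoc, div_self (pow_pos h0 _).ne',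
    div_self (pow_pos (h0.trans hmt) _).ne'] at this
  exact lt_irrefl _ this

lemma artanh_unbounded (M : ℝ) : ∃ s ∈ Ioo (0 : ℝ) 1, ∀ t ∈ Ico s 1, M < Real.artanh t := by
  refine ⟨Real.tanh (|M| + 1), ⟨?_, Real.tanh_lt_one _⟩, fun t ht => ?_⟩
  · rw [Real.tanh_eq_sinh_div_cosh]
    exact div_pos (Real.sinh_pos_iff.mpr (by positivity)) (Real.cosh_pos _)
  · have := Real.artanh_le_artanh (Real.neg_one_lt_tanh _) ht.2 ht.1
    rw [Real.artanh_tanh] at this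
    linarith [le_abs_self M]

/-- Near $1$ the polynomial part of $g'$ is at most $p|\beta|$ while $\operatorname{artanh}$ blows
up, so $g$ decreases into the endpoint. -/
lemma freeEnergy_one_not_max {p : ℕ} (β : ℝ) :
    ∃ t ∈ Icc (0 : ℝ) 1, freeEnergy p β 1 < freeEnergy p β t := by
  obtain ⟨s, hs, hs'⟩ := artanh_unbounded (p * |β|)
  refine ⟨s, ⟨hs.1.le, hs.2.le⟩, ?_⟩
  have : StrictAntiOn (freeEnergy p β) (Icc s 1) := by
    refine strictAntiOn_of_deriv_neg (convex_Icc s 1) (continuous_freeEnergy p β).continuousOn ?_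
    intro x hx
    rw [interior_Icc] at hx
    have hx0 : 0 < x := hs.1.trans hx.1
    rw [(hasDerivAt_freeEnergy p β ⟨by linarith [hx.1], by linarith [hx.2]⟩).deriv]
    have h1 := hs' x ⟨hx.1.le, hx.2⟩
    have h2 : x ^ (p - 1) ≤ 1 := pow_le_one₀ hx0.le hx.2.le
    have h3 : 0 ≤ x ^ (p - 1) := pow_nonneg hx0.le _
    have h4 : (p : ℝ) * β * x ^ (p - 1) ≤ p * |β| := by
      calc (p : ℝ) * β * x ^ (p - 1) ≤ p * |β| * x ^ (p - 1) := by
            gcongr; exact le_abs_self β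
        _ ≤ p * |β| * 1 := by gcongr
        _ = p * |β| := mul_one _
    linarith
  exact this (left_mem_Icc.mpr hs.2.le) (right_mem_Icc.mpr hs.2.le) hs.2

/-! ### The positive peak: existence, uniqueness, local and global shape -/

/-- The properties of the positive global maximizer of `freeEnergy p β` used below. -/
structure IsPeak (p : ℕ) (β m : ℝ) : Prop where
  pos : 0 < m
  lt_one : m < 1
  critical : p * β * m ^ (p - 1) = Real.artanh m
  slope_pos : 0 < slope p m
  value_pos : 0 < freeEnergy p β m
  isMaxOn : IsMaxOn (freeEnergy p β) (Icc (-1) 1) m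
  unique : ∀ t ∈ Icc (-1 : ℝ) 1, 0 < t → IsMaxOn (freeEnergy p β) (Icc (-1) 1) t → t = m

lemma critical_of_isMaxOn {p : ℕ} (hp : 2 ≤ p) {β t : ℝ} (hβ : threshold p < β)
    (ht : t ∈ Icc (-1 : ℝ) 1) (ht0 : 0 < t) (hmax : IsMaxOn (freeEnergy p β) (Icc (-1) 1) t) :
    t < 1 ∧ p * β * t ^ (p - 1) = Real.artanh t ∧ 0 < freeEnergy p β t ∧ 0 < slope p t := by
  have hsub : Icc (0 : ℝ) 1 ⊆ Icc (-1) 1 := Icc_subset_Icc (by norm_num) le_rfl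
  have hpos : 0 < freeEnergy p β t := by
    obtain ⟨s, hs, hs'⟩ := exists_freeEnergy_pos hp hβ
    exact hs'.trans_le (hmax (hsub hs))
  have h1 : t < 1 := by
    refine lt_of_le_of_ne ht.2 ?_
    rintro rfl
    obtain ⟨s, hs, hs'⟩ := freeEnergy_one_not_max (p := p) β
    exact absurd (hmax (hsub hs)) (not_le.mpr hs')
  have hin : t ∈ Ioo (-1 : ℝ) 1 := ⟨by linarith, h1⟩
  have hloc : IsLocalMax (freeEnergy p β) t := hmax.isLocalMax (Icc_mem_nhds hin.1 hin.2)
  have hcrit := hloc.hasDerivAt_eq_zero (hasDerivAt_freeEnergy p β hin)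
  have hcrit' : p * β * t ^ (p - 1) = Real.artanh t := by linarith
  exact ⟨h1, hcrit', hpos, slope_pos_of_critical hp ht0 h1 hcrit' hpos⟩

lemma exists_isPeak {p : ℕ} (hp : 2 ≤ p) {β : ℝ} (hβ : threshold p < β) : ∃ m, IsPeak p β m := by
  have hβ0 := pos_of_threshold_lt hβ
  obtain ⟨m, hm, hmax⟩ := (isCompact_Icc (a := (0 : ℝ)) (b := 1)).exists_isMaxOn
    ⟨0, left_mem_Icc.mpr zero_le_one⟩ (continuous_freeEnergy p β).continuousOn
  -- The maximum over $[0,1]$ is global: for even $p$ by reflection, for odd $p$ because $g\le 0$ on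
  -- the negative side.
  have hmax' : IsMaxOn (freeEnergy p β) (Icc (-1) 1) m := by
    intro t ht
    rcases le_total 0 t with h0 | h0
    · exact hmax ⟨h0, ht.2⟩
    · by_cases hev : Even p
      · have : freeEnergy p β (-t) ≤ freeEnergy p β m :=
          hmax ⟨by linarith, by linarith [ht.1]⟩
        rwa [freeEnergy_neg hev] at this
      · have h2 : freeEnergy p β 0 ≤ freeEnergy p β m := hmax (left_mem_Icc.mpr zero_le_one)
        rw [freeEnergy_zero hp] at h2
        exact (freeEnergy_nonpos_of_odd hev hβ0.le ht h0).trans h2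
  have hm0 : 0 < m := by
    refine lt_of_le_of_ne hm.1 ?_
    rintro rfl
    obtain ⟨s, hs, hs'⟩ := exists_freeEnergy_pos hp hβ
    have : freeEnergy p β s ≤ freeEnergy p β 0 := hmax hs
    rw [freeEnergy_zero hp] at this
    linarith
  obtain ⟨h1, hc, hv, hs⟩ := critical_of_isMaxOn hp hβ ⟨by linarith, hm.2⟩ hm0 hmax'
  refine ⟨m, hm0, h1, hc, hs, hv, hmax', fun t ht ht0 htm => ?_⟩
  obtain ⟨h1', hc', hv', hs'⟩ := critical_of_isMaxOn hp hβ ht ht0 htm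
  rcases lt_trichotomy t m with h | h | h
  · exact (critical_unique hp ht0 h h1 hc' hc hs').elim
  · exact h
  · exact (critical_unique hp hm0 h h1' hc hc' hs).elim

lemma hasDerivAt_deriv_freeEnergy (p : ℕ) (β : ℝ) {t : ℝ} (ht : t ∈ Ioo (-1 : ℝ) 1) :
    HasDerivAt (fun t => p * β * t ^ (p - 1) - Real.artanh t)
      (p * β * ((p - 1 : ℕ) * t ^ (p - 1 - 1)) - 1 / (1 - t ^ 2)) t :=
  ((hasDerivAt_pow (p - 1) t).const_mul (p * β)).sub (hasDerivAt_artanh ht)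

namespace IsPeak

variable {p : ℕ} {β m : ℝ}

lemma mem_Ioo (h : IsPeak p β m) : m ∈ Ioo (-1 : ℝ) 1 := ⟨by linarith [h.pos], h.lt_one⟩

lemma second_deriv_eq (h : IsPeak p β m) (hp : 2 ≤ p) :
    p * β * ((p - 1 : ℕ) * m ^ (p - 1 - 1)) - 1 / (1 - m ^ 2) = -(slope p m / m) := by
  have hm := h.pos.ne'
  have h3 := (one_sub_sq_pos h.mem_Ioo).ne'
  unfold slope
  rw [← h.critical]
  obtain ⟨q, rfl⟩ := Nat.exists_eq_add_of_le' hp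
  rw [show q + 2 - 1 = q + 1 by omega, show q + 1 - 1 = q by omega]
  push_cast
  field_simp
  ring

lemma hasDerivAt_deriv (h : IsPeak p β m) (hp : 2 ≤ p) :
    HasDerivAt (fun t => p * β * t ^ (p - 1) - Real.artanh t) (-(slope p m / m)) m := by
  rw [← h.second_deriv_eq hp]
  exact hasDerivAt_deriv_freeEnergy p β h.mem_Ioo

lemma deriv_deriv (h : IsPeak p β m) (hp : 2 ≤ p) :
    deriv (deriv (freeEnergy p β)) m = -(slope p m / m) := by
  have : deriv (freeEnergy p β) =ᶠ[𝓝 m] fun t => p * β * t ^ (p - 1) - Real.artanh t := by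
    filter_upwards [isOpen_Ioo.mem_nhds h.mem_Ioo] with t ht
    exact (hasDerivAt_freeEnergy p β ht).deriv
  rw [this.deriv_eq, (h.hasDerivAt_deriv hp).deriv]

lemma curvature_pos (h : IsPeak p β m) : 0 < slope p m / m := div_pos h.slope_pos h.pos

/-- Only differentiability of $g'$ at the single point $m$ is used: the remainder has derivative
$o(|x-m|)$, and the mean value inequality along the segment from $m$ to $t$ integrates this bound.
-/
lemma taylor (h : IsPeak p β m) (hp : 2 ≤ p) :
    (fun t => freeEnergy p β t - freeEnergy p β m + slope p m / m / 2 * (t - m) ^ 2)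
      =o[𝓝 m] fun t => (t - m) ^ 2 := by
  set c := slope p m / m
  rw [Asymptotics.isLittleO_iff]
  intro ε hε
  have hd := (hasDerivAt_iff_isLittleO.mp (h.hasDerivAt_deriv hp))
  rw [Asymptotics.isLittleO_iff] at hd
  have hev := (hd hε).and (isOpen_Ioo.mem_nhds h.mem_Ioo)
  obtain ⟨r, hr, hball⟩ := Metric.eventually_nhds_iff_ball.mp hev
  filter_upwards [Metric.ball_mem_nhds m hr] with t ht
  have hderiv : ∀ x ∈ Metric.ball m r, HasDerivAt
      (fun t => freeEnergy p β t - freeEnergy p β m + c / 2 * (t - m) ^ 2)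
      ((p * β * x ^ (p - 1) - Real.artanh x) + c * (x - m)) x := by
    intro x hx
    have e := ((hasDerivAt_freeEnergy p β (hball x hx).2).sub_const (freeEnergy p β m)).add
      ((((hasDerivAt_id x).sub_const m).pow 2).const_mul (c / 2))
    refine HasDerivAt.congr_deriv e ?_
    simp only [id]
    push_cast
    ring
  have hseg : segment ℝ m t ⊆ Metric.ball m r :=
    (convex_ball m r).segment_subset (Metric.mem_ball_self hr) ht
  have hb := (convex_segment m t).norm_image_sub_le_of_norm_hasDerivWithin_le
    (C := ε * ‖t - m‖) (fun x hx => (hderiv x (hseg hx)).hasDerivWithinAt)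
    (fun x hx => by
      have h1 := (hball x (hseg hx)).1
      simp only [← h.critical, sub_self, smul_eq_mul] at h1
      have h2 : ‖x - m‖ ≤ ‖t - m‖ := by
        obtain ⟨a, b, ha, hb, hab, rfl⟩ := hx
        have : a • m + b • t - m = b * (t - m) := by
          simp only [smul_eq_mul]
          linear_combination m * hab
        rw [this, norm_mul]
        exact mul_le_of_le_one_left (norm_nonneg _)
          (by rw [Real.norm_of_nonneg hb]; linarith)
      calc ‖(p * β * x ^ (p - 1) - Real.artanh x) + c * (x - m)‖
          = ‖p * β * x ^ (p - 1) - Real.artanh x - 0 - (x - m) * -c‖ := by congr 1; ring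
        _ ≤ ε * ‖x - m‖ := h1
        _ ≤ ε * ‖t - m‖ := by gcongr)
    (left_mem_segment ℝ m t) (right_mem_segment ℝ m t)
  simp only [sub_self, ne_eq, OfNat.ofNat_ne_zero, not_false_eq_true, zero_pow, mul_zero, add_zero,
    sub_zero] at hb
  calc _ ≤ _ := hb
    _ = ε * ‖(t - m) ^ 2‖ := by rw [norm_pow]; ring

/-- Half of the quadratic coefficient $c/2$, with $c=-g''(m)$, is sacrificed to absorb the Taylor
remainder. Keeping the window inside $(0,1)$ separates it from its reflection and keeps Stirling's
prefactor bounded. -/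
lemma exists_window (h : IsPeak p β m) (hp : 2 ≤ p) : ∃ δ > 0, 0 < m - δ ∧ m + δ < 1 ∧
    ∀ t, |t - m| ≤ δ →
      freeEnergy p β t - freeEnergy p β m ≤ -(slope p m / m / 4) * (t - m) ^ 2 := by
  have hc := h.curvature_pos
  have ht := (Asymptotics.isLittleO_iff.mp (h.taylor hp))
    (show 0 < slope p m / m / 4 by positivity)
  obtain ⟨r, hr, hball⟩ := Metric.eventually_nhds_iff_ball.mp ht
  have hmin : 0 < min r (min m (1 - m)) :=
    lt_min hr (lt_min h.pos (by linarith [h.lt_one]))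
  refine ⟨min r (min m (1 - m)) / 2, by positivity, ?_, ?_, fun t htm => ?_⟩
  · have := (min_le_right r (min m (1 - m))).trans (min_le_left _ _)
    linarith [h.pos]
  · have := (min_le_right r (min m (1 - m))).trans (min_le_right _ _)
    linarith [h.lt_one]
  · have h1 := hball t (by
      rw [Metric.mem_ball, Real.dist_eq]
      have := min_le_left r (min m (1 - m))
      linarith)
    have h2 := (le_abs_self _).trans h1
    rw [Real.norm_of_nonneg (sq_nonneg _)] at h2
    linarith

lemma tendsto_mul_freeEnergy (h : IsPeak p β m) (hp : 2 ≤ p) {t : ℕ → ℝ} {z : ℝ}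
    (ht : Tendsto (fun N : ℕ => Real.sqrt N * (t N - m)) atTop (𝓝 z)) (htm : Tendsto t atTop (𝓝 m)) :
    Tendsto (fun N : ℕ => (N : ℝ) * (freeEnergy p β (t N) - freeEnergy p β m)) atTop
      (𝓝 (-(slope p m / m / 2) * z ^ 2)) := by
  have h1 := (h.taylor hp).comp_tendsto htm
  have h2 : (fun N : ℕ => (N : ℝ) * (freeEnergy p β (t N) - freeEnergy p β m
      + slope p m / m / 2 * (t N - m) ^ 2)) =o[atTop] fun N : ℕ => (N : ℝ) * (t N - m) ^ 2 :=
    (Asymptotics.isBigO_refl _ _).mul_isLittleO h1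
  have h3 : ∀ N : ℕ, (N : ℝ) * (t N - m) ^ 2 = (Real.sqrt N * (t N - m)) ^ 2 := fun N => by
    rw [mul_pow, Real.sq_sqrt (Nat.cast_nonneg N)]
  have h4 : Tendsto (fun N : ℕ => (N : ℝ) * (t N - m) ^ 2) atTop (𝓝 (z ^ 2)) := by
    simp_rw [h3]
    exact ht.pow 2
  have h5 := (h2.trans_isBigO (h4.isBigO_one ℝ)).tendsto_zero_of_tendsto tendsto_const_nhds |>.sub
    (h4.const_mul (slope p m / m / 2))
  rw [zero_sub, ← neg_mul] at h5
  refine h5.congr fun N => ?_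
  ring

/-- Compactness: off the windows there is no global maximizer, so $g$ has a maximum there strictly
below $g(m)$. The window around $-m$ is removed only for even $p$, when $-m$ is also a maximizer. -/
lemma exists_gap (h : IsPeak p β m) (hp : 2 ≤ p) (hβ : 0 ≤ β) {δ : ℝ} (hδ : 0 < δ) :
    ∃ ε > 0, ∀ t ∈ Icc (-1 : ℝ) 1, δ ≤ |t - m| → (Even p → δ ≤ |-t - m|) →
      freeEnergy p β t ≤ freeEnergy p β m - ε := by
  set s : Set ℝ := {t | t ∈ Icc (-1 : ℝ) 1 ∧ δ ≤ |t - m| ∧ (Even p → δ ≤ |-t - m|)} with hs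
  have hcl : IsClosed {t : ℝ | δ ≤ |t - m|} :=
    isClosed_le continuous_const (by fun_prop)
  have hcl' : IsClosed {t : ℝ | Even p → δ ≤ |-t - m|} := by
    by_cases hev : Even p
    · simp only [hev, true_imp_iff]
      exact isClosed_le continuous_const (by fun_prop)
    · simp [hev]
  have hcomp : IsCompact s := isCompact_Icc.inter_right (hcl.inter hcl')
  have hlt : ∀ t ∈ s, freeEnergy p β t < freeEnergy p β m := by
    rintro t ⟨ht, h1, h2⟩
    refine lt_of_le_of_ne (h.isMaxOn ht) fun heq => ?_
    have key : ∀ u ∈ Icc (-1 : ℝ) 1, 0 < u → freeEnergy p β u = freeEnergy p β m → u = m := by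
      intro u hu hu0 hum
      refine h.unique u hu hu0 fun x hx => ?_
      have : freeEnergy p β x ≤ freeEnergy p β m := h.isMaxOn hx
      rwa [← hum] at this
    rcases lt_trichotomy t 0 with h0 | h0 | h0
    · by_cases hev : Even p
      · have := key (-t) ⟨by linarith [ht.2], by linarith [ht.1]⟩ (by linarith)
          (by rw [freeEnergy_neg hev, heq])
        have h3 := h2 hev
        rw [this, sub_self, abs_zero] at h3
        linarith
      · have := freeEnergy_nonpos_of_odd hev hβ ht h0.le
        linarith [h.value_pos]
    · rw [h0, freeEnergy_zero hp] at heq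
      linarith [h.value_pos]
    · rw [key t ht h0 heq, sub_self, abs_zero] at h1
      linarith
  rcases s.eq_empty_or_nonempty with hemp | hne
  · refine ⟨1, one_pos, fun t ht h1 h2 => ?_⟩
    have : t ∈ s := ⟨ht, h1, h2⟩
    simp [hemp] at this
  · obtain ⟨x, hx, hxmax⟩ := hcomp.exists_isMaxOn hne (continuous_freeEnergy p β).continuousOn
    refine ⟨freeEnergy p β m - freeEnergy p β x, sub_pos.mpr (hlt x hx), fun t ht h1 h2 => ?_⟩
    have : freeEnergy p β t ≤ freeEnergy p β x := hxmax ⟨ht, h1, h2⟩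
    linarith

end IsPeak

/-! ### Stirling asymptotics for binomial weights -/

/-- The average of `N` spins, `k` of which are `+1`. -/
noncomputable def gridPoint (N k : ℕ) : ℝ := (2 * k - N) / N

/-- The binomial probability of `k` successes, rescaled by the entropy of `gridPoint N k`. -/
noncomputable def entropicBinomial (N k : ℕ) : ℝ :=
  (N.choose k : ℝ) / 2 ^ N * Real.exp (N * entropy (gridPoint N k))

lemma entropicBinomial_nonneg (N k : ℕ) : 0 ≤ entropicBinomial N k := by
  unfold entropicBinomial; positivity

lemma gridPoint_mem_Icc {N k : ℕ} (hN : 0 < N) (hk : k ≤ N) : gridPoint N k ∈ Icc (-1 : ℝ) 1 := by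
  have hN' : (0 : ℝ) < N := by exact_mod_cast hN
  have hk' : (k : ℝ) ≤ N := by exact_mod_cast hk
  have hk0 : (0 : ℝ) ≤ k := Nat.cast_nonneg k
  unfold gridPoint
  constructor
  · rw [le_div_iff₀ hN']; linarith
  · rw [div_le_iff₀ hN']; linarith

lemma gridPoint_zero {N : ℕ} (hN : 0 < N) : gridPoint N 0 = -1 := by
  have hN' : (N : ℝ) ≠ 0 := by exact_mod_cast hN.ne'
  unfold gridPoint
  field_simp
  simp

lemma gridPoint_self {N : ℕ} (hN : 0 < N) : gridPoint N N = 1 := by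
  have hN' : (N : ℝ) ≠ 0 := by exact_mod_cast hN.ne'
  unfold gridPoint
  field_simp
  ring

lemma gridPoint_sub {N k : ℕ} (hk : k ≤ N) : gridPoint N (N - k) = -gridPoint N k := by
  unfold gridPoint
  push_cast [hk]
  ring

lemma factorial_eq_stirlingSeq_mul {n : ℕ} (hn : n ≠ 0) :
    (n.factorial : ℝ) = Stirling.stirlingSeq n * (Real.sqrt (2 * n) * (n / Real.exp 1) ^ n) := by
  have : 0 < (n : ℝ) := by positivity
  unfold Stirling.stirlingSeq
  field_simp

lemma stirlingSeq_pos {n : ℕ} (hn : n ≠ 0) : 0 < Stirling.stirlingSeq n := by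
  obtain ⟨k, rfl⟩ := Nat.exists_eq_succ_of_ne_zero hn
  exact Stirling.stirlingSeq'_pos k

lemma stirlingSeq_le_one {n : ℕ} (hn : n ≠ 0) : Stirling.stirlingSeq n ≤ Stirling.stirlingSeq 1 := by
  obtain ⟨k, rfl⟩ := Nat.exists_eq_succ_of_ne_zero hn
  exact Stirling.stirlingSeq'_antitone (Nat.zero_le k)

/-- The Stirling sequence decreases to $\sqrt\pi$, so the numerator is at most its first term and
each denominator factor at least $\sqrt\pi$. -/
lemma stirlingSeq_div_le {n k j : ℕ} (hn : n ≠ 0) (hk : k ≠ 0) (hj : j ≠ 0) :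
    Stirling.stirlingSeq n / (Stirling.stirlingSeq k * Stirling.stirlingSeq j) ≤
      Stirling.stirlingSeq 1 / Real.pi := by
  have hpi := Real.pi_pos
  have h1 := stirlingSeq_pos one_ne_zero
  have e4 : Real.pi ≤ Stirling.stirlingSeq k * Stirling.stirlingSeq j := by
    calc Real.pi = Real.sqrt Real.pi * Real.sqrt Real.pi := (Real.mul_self_sqrt hpi.le).symm
      _ ≤ _ := mul_le_mul (Stirling.sqrt_pi_le_stirlingSeq hk) (Stirling.sqrt_pi_le_stirlingSeq hj)
          (Real.sqrt_nonneg _) (stirlingSeq_pos hk).le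
  have := stirlingSeq_le_one hn
  gcongr

lemma exp_mul_entropy_gridPoint {k j : ℕ} (hk : k ≠ 0) (hj : j ≠ 0) :
    Real.exp ((k + j : ℕ) * entropy (gridPoint (k + j) k)) =
      (2 * k / (k + j)) ^ k * (2 * j / (k + j)) ^ j := by
  have hk' : (0 : ℝ) < k := by positivity
  have hj' : (0 : ℝ) < j := by positivity
  have h1 : 1 + gridPoint (k + j) k = 2 * k / (k + j) := by
    unfold gridPoint; push_cast; field_simp; ring
  have h2 : 1 - gridPoint (k + j) k = 2 * j / (k + j) := by
    unfold gridPoint; push_cast; field_simp; ring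
  have h3 : ((k + j : ℕ) : ℝ) * entropy (gridPoint (k + j) k) =
      k * Real.log (2 * k / (k + j)) + j * Real.log (2 * j / (k + j)) := by
    unfold entropy
    rw [h1, h2]
    push_cast
    field_simp
  rw [h3, Real.exp_add, ← Real.log_pow, ← Real.log_pow, Real.exp_log (by positivity),
    Real.exp_log (by positivity)]

/-- The powers $n^n$ and $e^{-n}$ in the three factorials cancel exactly against the entropy
exponential, leaving an identity with only the square-root prefactor and the Stirling ratio. -/
lemma entropicBinomial_add {k j : ℕ} (hk : k ≠ 0) (hj : j ≠ 0) :
    entropicBinomial (k + j) k =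
      Stirling.stirlingSeq (k + j) / (Stirling.stirlingSeq k * Stirling.stirlingSeq j) *
        Real.sqrt ((k + j) / (2 * k * j)) := by
  have hk' : (0 : ℝ) < k := by positivity
  have hj' : (0 : ℝ) < j := by positivity
  have sk := stirlingSeq_pos hk
  have sj := stirlingSeq_pos hj
  have hsq : Real.sqrt ((k + j) / (2 * k * j)) =
      Real.sqrt (2 * (k + j : ℕ)) / (Real.sqrt (2 * k) * Real.sqrt (2 * j)) := by
    rw [← Real.sqrt_mul (by positivity), ← Real.sqrt_div (by positivity)]
    congr 1
    push_cast
    field_simp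
  unfold entropicBinomial
  rw [exp_mul_entropy_gridPoint hk hj, Nat.choose_symm_add, Nat.add_choose, Nat.cast_div
    (Nat.factorial_mul_factorial_dvd_factorial_add k j) (by positivity), Nat.cast_mul,
    factorial_eq_stirlingSeq_mul hk, factorial_eq_stirlingSeq_mul hj,
    factorial_eq_stirlingSeq_mul (n := k + j) (by omega), hsq]
  simp only [div_pow, mul_pow, pow_add]
  push_cast
  have : 0 < Real.exp 1 := Real.exp_pos 1
  have h1 : 0 < Real.sqrt (2 * k) := by positivity
  have h2 : 0 < Real.sqrt (2 * j) := by positivity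
  field_simp

/-- Stirling's formula for `entropicBinomial`. -/
lemma sqrt_mul_entropicBinomial {N k : ℕ} (hk : 0 < k) (hkN : k < N) :
    Real.sqrt N * entropicBinomial N k =
      Stirling.stirlingSeq N / (Stirling.stirlingSeq k * Stirling.stirlingSeq (N - k)) *
        Real.sqrt (2 / (1 - gridPoint N k ^ 2)) := by
  obtain ⟨j, rfl⟩ := Nat.exists_eq_add_of_lt hkN
  rw [show k + j + 1 - k = j + 1 by omega, add_assoc, entropicBinomial_add hk.ne' (by omega)]
  have hk' : (0 : ℝ) < k := by positivity
  have hj' : (0 : ℝ) < j + 1 := by positivity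
  rw [mul_left_comm, ← Real.sqrt_mul (by positivity)]
  congr 2
  have : 1 - gridPoint (k + (j + 1)) k ^ 2 = 4 * k * (j + 1) / (k + (j + 1)) ^ 2 := by
    unfold gridPoint; push_cast; field_simp; ring
  rw [this]
  push_cast
  field_simp
  ring

/-- Crude bound for the region away from the peaks. The value is exactly $1$ at $k=0$ and $k=N$,
hence the summand $1$; in between, the square-root factor is at most $1$. -/
lemma entropicBinomial_le {N k : ℕ} (hN : 0 < N) (hk : k ≤ N) :
    entropicBinomial N k ≤ 1 + Stirling.stirlingSeq 1 / Real.pi := by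
  have h1 : 0 < Stirling.stirlingSeq 1 := stirlingSeq_pos one_ne_zero
  have hpi := Real.pi_pos
  have hone : ∀ n : ℕ, (1 : ℝ) / 2 ^ n * Real.exp (n * Real.log 2) = 1 := fun n => by
    rw [← Real.log_pow, Real.exp_log (by positivity)]
    field_simp
  have hext : (1 : ℝ) ≤ 1 + Stirling.stirlingSeq 1 / Real.pi := by
    have : 0 < Stirling.stirlingSeq 1 / Real.pi := by positivity
    linarith
  rcases Nat.eq_zero_or_pos k with h0 | h0
  · unfold entropicBinomial
    rw [h0, gridPoint_zero hN, entropy_neg, entropy_one, Nat.choose_zero_right, Nat.cast_one, hone]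
    exact hext
  rcases hk.eq_or_lt with rfl | hlt
  · unfold entropicBinomial
    rw [gridPoint_self hN, entropy_one, Nat.choose_self, Nat.cast_one, hone]
    exact hext
  obtain ⟨j, rfl⟩ := Nat.exists_eq_add_of_lt hlt
  rw [add_assoc, entropicBinomial_add h0.ne' (by omega)]
  have hk1 : (1 : ℝ) ≤ k := by exact_mod_cast h0
  have hj1 : (1 : ℝ) ≤ ((j + 1 : ℕ) : ℝ) := by exact_mod_cast Nat.succ_pos j
  have hs : Real.sqrt ((k + (j + 1 : ℕ)) / (2 * k * (j + 1 : ℕ))) ≤ 1 := by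
    rw [Real.sqrt_le_one, div_le_one (by positivity)]
    nlinarith
  calc _ ≤ Stirling.stirlingSeq 1 / Real.pi * 1 :=
        mul_le_mul (stirlingSeq_div_le (by omega) h0.ne' (by omega)) hs (Real.sqrt_nonneg _)
          (by positivity)
    _ ≤ _ := by linarith

lemma pos_and_lt_of_gridPoint {N k : ℕ} (hN : 0 < N) (h : gridPoint N k ∈ Ioo (-1 : ℝ) 1) :
    0 < k ∧ k < N := by
  have hN' : (0 : ℝ) < N := by exact_mod_cast hN
  obtain ⟨h1, h2⟩ := h
  unfold gridPoint at h1 h2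
  rw [lt_div_iff₀ hN'] at h1
  rw [div_lt_iff₀ hN'] at h2
  constructor
  · have : (0 : ℝ) < k := by linarith
    exact_mod_cast this
  · have : (k : ℝ) < N := by linarith
    exact_mod_cast this

lemma sqrt_mul_entropicBinomial_le {N k : ℕ} (hN : 0 < N) {r : ℝ} (hr : r < 1)
    (h : |gridPoint N k| ≤ r) :
    Real.sqrt N * entropicBinomial N k ≤
      Stirling.stirlingSeq 1 / Real.pi * Real.sqrt (2 / (1 - r ^ 2)) := by
  have hpi := Real.pi_pos
  obtain ⟨h0, hlt⟩ := pos_and_lt_of_gridPoint hN (abs_lt.mp (h.trans_lt hr))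
  rw [sqrt_mul_entropicBinomial h0 hlt]
  have hr0 : 0 ≤ r := (abs_nonneg _).trans h
  have e6 : gridPoint N k ^ 2 ≤ r ^ 2 := sq_le_sq' (abs_le.mp h).1 (abs_le.mp h).2
  have e7 : 0 < 1 - r ^ 2 := by nlinarith
  have e8 := stirlingSeq_pos one_ne_zero
  refine mul_le_mul (stirlingSeq_div_le (by omega) (by omega) (by omega)) ?_ (Real.sqrt_nonneg _)
    (by positivity)
  gcongr

lemma tendsto_sqrt_mul_entropicBinomial {k : ℕ → ℕ} {m : ℝ} (hm : m ∈ Ioo (-1 : ℝ) 1)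
    (hk : Tendsto (fun N => gridPoint N (k N)) atTop (𝓝 m)) :
    Tendsto (fun N : ℕ => Real.sqrt N * entropicBinomial N (k N)) atTop
      (𝓝 (1 / Real.sqrt Real.pi * Real.sqrt (2 / (1 - m ^ 2)))) := by
  have hsqpi : 0 < Real.sqrt Real.pi := Real.sqrt_pos.mpr Real.pi_pos
  have hmem : ∀ᶠ N in atTop, 0 < N ∧ 0 < k N ∧ k N < N := by
    filter_upwards [hk.eventually (isOpen_Ioo.mem_nhds hm), eventually_gt_atTop 0] with N hN hN0
    exact ⟨hN0, pos_and_lt_of_gridPoint hN0 hN⟩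
  have hcast : Tendsto (fun N : ℕ => (N : ℝ)) atTop atTop := tendsto_natCast_atTop_atTop
  have hk1 : Tendsto k atTop atTop := by
    rw [← tendsto_natCast_atTop_iff (R := ℝ)]
    have h1 : Tendsto (fun N : ℕ => (1 + gridPoint N (k N)) / 2 * (N : ℝ)) atTop atTop :=
      Tendsto.pos_mul_atTop (by linarith [hm.1]) ((hk.const_add 1).div_const 2) hcast
    refine h1.congr' ?_
    filter_upwards [eventually_gt_atTop 0] with N hN
    have : (N : ℝ) ≠ 0 := by positivity
    unfold gridPoint
    field_simp
    ring
  have hk2 : Tendsto (fun N => N - k N) atTop atTop := by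
    rw [← tendsto_natCast_atTop_iff (R := ℝ)]
    have h1 : Tendsto (fun N : ℕ => (1 - gridPoint N (k N)) / 2 * (N : ℝ)) atTop atTop :=
      Tendsto.pos_mul_atTop (by linarith [hm.2]) ((hk.const_sub 1).div_const 2) hcast
    refine h1.congr' ?_
    filter_upwards [hmem] with N hN
    have : (N : ℝ) ≠ 0 := by exact_mod_cast hN.1.ne'
    rw [Nat.cast_sub hN.2.2.le]
    unfold gridPoint
    field_simp
    ring
  have hS := Stirling.tendsto_stirlingSeq_sqrt_pi
  have h1 := hS.div ((hS.comp hk1).mul (hS.comp hk2)) (by positivity)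
  have hne : 1 - m ^ 2 ≠ 0 := (one_sub_sq_pos hm).ne'
  have h2 : Tendsto (fun N => Real.sqrt (2 / (1 - gridPoint N (k N) ^ 2))) atTop
      (𝓝 (Real.sqrt (2 / (1 - m ^ 2)))) :=
    (Tendsto.div tendsto_const_nhds ((hk.pow 2).const_sub 1) hne).sqrt
  have h3 := h1.mul h2
  rw [show Real.sqrt Real.pi / (Real.sqrt Real.pi * Real.sqrt Real.pi) = 1 / Real.sqrt Real.pi by
    field_simp] at h3
  refine h3.congr' ?_
  filter_upwards [hmem] with N hN
  exact (sqrt_mul_entropicBinomial hN.2.1 hN.2.2).symm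

/-! ### From sums to integrals -/

/-- Each $k$ owns the unit interval $[k,k+1)$. Vanishing at $0$ is needed because the natural floor
sends the whole negative half-line to $0$. -/
lemma sum_range_eq_integral_floor {φ : ℕ → ℝ} {n : ℕ} (h0 : φ 0 = 0) (hn : ∀ k, n < k → φ k = 0) :
    ∑ k ∈ Finset.range (n + 1), φ k = ∫ y : ℝ, φ ⌊y⌋₊ := by
  have h1 : (fun y : ℝ => φ ⌊y⌋₊) = fun y => ∑ k ∈ Finset.range (n + 1),
      (Ico (k : ℝ) (k + 1)).indicator (fun _ => φ k) y := by
    funext y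
    by_cases hy : 0 ≤ y
    · have hiff : ∀ k : ℕ, y ∈ Ico (k : ℝ) (k + 1) ↔ ⌊y⌋₊ = k := fun k =>
        (Nat.floor_eq_iff hy).symm
      simp only [indicator_apply, hiff]
      rw [Finset.sum_ite_eq]
      split_ifs with h
      · rfl
      · exact hn _ (by simpa using h)
    · rw [Nat.floor_of_nonpos (not_le.mp hy).le, h0]
      refine (Finset.sum_eq_zero fun k _ => indicator_of_notMem (fun hk => hy ?_) _).symm
      exact (Nat.cast_nonneg k).trans hk.1
  rw [h1, integral_finsetSum]
  · refine Finset.sum_congr rfl fun k _ => ?_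
    rw [integral_indicator_const _ measurableSet_Ico]
    simp
  · intro k _
    exact (integrable_indicator_iff measurableSet_Ico).mpr
      (integrableOn_const (by simp))

lemma sum_range_eq_integral_floor_affine {φ : ℕ → ℝ} {n : ℕ} (h0 : φ 0 = 0)
    (hn : ∀ k, n < k → φ k = 0) (A : ℝ) {B : ℝ} (hB : 0 < B) :
    ∑ k ∈ Finset.range (n + 1), φ k = ∫ z : ℝ, B * φ ⌊A + B * z⌋₊ := by
  rw [sum_range_eq_integral_floor h0 hn, integral_const_mul,
    Measure.integral_comp_mul_left (fun y : ℝ => φ ⌊A + y⌋₊) B,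
    integral_add_left_eq_self (fun y : ℝ => φ ⌊y⌋₊) A, abs_of_pos (inv_pos.mpr hB), smul_eq_mul,
    mul_inv_cancel_left₀ hB.ne']

/-- Makes the Gaussian bound at the rounded point $v$ into one at $z$: half of the exponent absorbs
the factor $1+v^2$, and $z^2\le 2v^2+8$ converts the other half. -/
lemma one_add_sq_mul_exp_le {a v z : ℝ} (ha : 0 < a) (hvz : |v - z| ≤ 2) :
    (1 + v ^ 2) * Real.exp (-a * v ^ 2) ≤
      (1 + 2 / a) * Real.exp (2 * a) * Real.exp (-(a / 4) * z ^ 2) := by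
  have h1 : 1 + v ^ 2 ≤ (1 + 2 / a) * Real.exp (a / 2 * v ^ 2) := by
    have e1 := Real.add_one_le_exp (a / 2 * v ^ 2)
    have e2 : (1 : ℝ) ≤ Real.exp (a / 2 * v ^ 2) := Real.one_le_exp (by positivity)
    have e3 : v ^ 2 = 2 / a * (a / 2 * v ^ 2) := by field_simp
    have e4 : v ^ 2 ≤ 2 / a * Real.exp (a / 2 * v ^ 2) := by
      rw [e3]
      have : 0 < 2 / a := by positivity
      gcongr
      rw [← e3]; linarith
    linarith
  have h2 : z ^ 2 / 2 - 4 ≤ v ^ 2 := by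
    have : (v - z) ^ 2 ≤ 2 ^ 2 := sq_le_sq' (by linarith [(abs_le.mp hvz).1]) (abs_le.mp hvz).2
    nlinarith [sq_nonneg (2 * v - z)]
  calc (1 + v ^ 2) * Real.exp (-a * v ^ 2)
      ≤ (1 + 2 / a) * Real.exp (a / 2 * v ^ 2) * Real.exp (-a * v ^ 2) := by gcongr
    _ = (1 + 2 / a) * Real.exp (-(a / 2) * v ^ 2) := by
      rw [mul_assoc, ← Real.exp_add]; congr 2; ring
    _ ≤ (1 + 2 / a) * Real.exp (2 * a + -(a / 4) * z ^ 2) := by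
      gcongr
      nlinarith
    _ = _ := by rw [Real.exp_add]; ring

/-! ### Laplace's method in a window around the peak -/

/-- The unnormalized weight of `k` positive spins under the Curie-Weiss law, relative to the
exponential growth rate `freeEnergy p β m`. -/
noncomputable def weight (p : ℕ) (β m : ℝ) (N k : ℕ) : ℝ :=
  entropicBinomial N k *
    Real.exp (N * (freeEnergy p β (gridPoint N k) - freeEnergy p β m))

lemma weight_nonneg (p : ℕ) (β m : ℝ) (N k : ℕ) : 0 ≤ weight p β m N k :=
  mul_nonneg (entropicBinomial_nonneg N k) (Real.exp_pos _).le

/-- The restriction to the window `|t - m| ≤ δ` of the summand `weight * f`. -/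
noncomputable def windowTerm (p : ℕ) (β m δ : ℝ) (f : ℕ → ℝ → ℝ) (N k : ℕ) : ℝ :=
  if |gridPoint N k - m| ≤ δ then weight p β m N k * f N (gridPoint N k) else 0

lemma sqrt_mul_gridPoint_sub {N : ℕ} (hN : 0 < N) (k : ℕ) (m : ℝ) :
    Real.sqrt N * (gridPoint N k - m) = (k - N * (1 + m) / 2) / (Real.sqrt N / 2) := by
  have hN' : (0 : ℝ) < N := by exact_mod_cast hN
  have hs : 0 < Real.sqrt N := Real.sqrt_pos.mpr hN'
  have h2 : (N : ℝ) = Real.sqrt N * Real.sqrt N := (Real.mul_self_sqrt hN'.le).symm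
  unfold gridPoint
  rw [eq_div_iff (by positivity)]
  have : Real.sqrt N * ((2 * (k : ℝ) - N) / N - m) * (Real.sqrt N / 2) =
      (Real.sqrt N * Real.sqrt N) * ((2 * (k : ℝ) - N) / N - m) / 2 := by ring
  rw [this, ← h2]
  field_simp
  ring

lemma abs_floor_sub_le {y : ℝ} (hy : 0 ≤ y) : |(⌊y⌋₊ : ℝ) - y| ≤ 1 := by
  rw [abs_le]
  constructor
  · linarith [Nat.lt_floor_add_one y]
  · linarith [Nat.floor_le hy]

/-- The number of positive spins at rescaled distance `z` from the peak. -/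
noncomputable def rescaledIndex (m : ℝ) (N : ℕ) (z : ℝ) : ℕ :=
  ⌊N * (1 + m) / 2 + Real.sqrt N / 2 * z⌋₊

lemma abs_sqrt_mul_gridPoint_sub_le {N : ℕ} (hN : 0 < N) {m z : ℝ}
    (hy : 0 ≤ N * (1 + m) / 2 + Real.sqrt N / 2 * z) :
    |Real.sqrt N * (gridPoint N (rescaledIndex m N z) - m) - z| ≤ 2 / Real.sqrt N := by
  have hN' : (0 : ℝ) < N := by exact_mod_cast hN
  have hs : 0 < Real.sqrt N := Real.sqrt_pos.mpr hN'
  have h := abs_floor_sub_le hy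
  rw [sqrt_mul_gridPoint_sub hN]
  unfold rescaledIndex
  have : ((⌊N * (1 + m) / 2 + Real.sqrt N / 2 * z⌋₊ : ℝ) - N * (1 + m) / 2) / (Real.sqrt N / 2) - z
      = ((⌊N * (1 + m) / 2 + Real.sqrt N / 2 * z⌋₊ : ℝ) - (N * (1 + m) / 2 + Real.sqrt N / 2 * z))
        * (2 / Real.sqrt N) := by
    field_simp
    ring
  rw [this, abs_mul, abs_of_pos (show 0 < 2 / Real.sqrt N by positivity)]
  exact mul_le_of_le_one_left (by positivity) h

lemma tendsto_sqrt_natCast : Tendsto (fun N : ℕ => Real.sqrt N) atTop atTop :=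
  Real.tendsto_sqrt_atTop.comp tendsto_natCast_atTop_atTop

lemma tendsto_sqrt_mul_gridPoint_sub {m : ℝ} (hm : 0 < 1 + m) (z : ℝ) :
    Tendsto (fun N : ℕ => Real.sqrt N * (gridPoint N (rescaledIndex m N z) - m)) atTop (𝓝 z) := by
  have hpos : ∀ᶠ N : ℕ in atTop, 0 ≤ N * (1 + m) / 2 + Real.sqrt N / 2 * z := by
    filter_upwards [tendsto_sqrt_natCast.eventually_ge_atTop (|z| / (1 + m))] with N hN
    rw [div_le_iff₀ hm] at hN
    have h1 : (N : ℝ) * (1 + m) = Real.sqrt N * (Real.sqrt N * (1 + m)) := by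
      rw [← mul_assoc, Real.mul_self_sqrt (Nat.cast_nonneg N)]
    have h2 : 0 ≤ Real.sqrt N * (Real.sqrt N * (1 + m) + z) :=
      mul_nonneg (Real.sqrt_nonneg _) (by linarith [neg_abs_le z])
    nlinarith
  rw [tendsto_iff_norm_sub_tendsto_zero]
  refine squeeze_zero' (Eventually.of_forall fun _ => norm_nonneg _) ?_
    (tendsto_sqrt_natCast.const_div_atTop 2)
  filter_upwards [hpos, eventually_gt_atTop 0] with N h1 h2
  exact abs_sqrt_mul_gridPoint_sub_le h2 h1

lemma tendsto_of_tendsto_sqrt_mul {t : ℕ → ℝ} {m z : ℝ}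
    (ht : Tendsto (fun N : ℕ => Real.sqrt N * (t N - m)) atTop (𝓝 z)) : Tendsto t atTop (𝓝 m) := by
  have h := (ht.div_atTop tendsto_sqrt_natCast).add_const m
  rw [zero_add] at h
  refine h.congr' ?_
  filter_upwards [eventually_gt_atTop 0] with N hN
  have hs : Real.sqrt N ≠ 0 := (Real.sqrt_pos.mpr (by exact_mod_cast hN)).ne'
  field_simp
  ring

section Window

variable {p : ℕ} {β m δ C : ℝ} {f : ℕ → ℝ → ℝ} {φ : ℝ → ℝ}

/-- The integrable dominating function: Stirling's bound in the window, the quadratic upper bound on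
$g$, and at most quadratic growth of the observable combine to a Gaussian in $z$ uniformly in $N$.
-/
lemma norm_windowTerm_le (h1 : m + δ < 1) (h0 : 0 < m - δ) {c : ℝ} (hc : 0 < c)
    (hquad : ∀ t, |t - m| ≤ δ → freeEnergy p β t - freeEnergy p β m ≤ -c * (t - m) ^ 2)
    (hC0 : 0 ≤ C) (hC : ∀ N t, |t - m| ≤ δ → |f N t| ≤ C * (1 + N * (t - m) ^ 2))
    {N : ℕ} (hN : 0 < N) (z : ℝ) :
    ‖Real.sqrt N / 2 * windowTerm p β m δ f N (rescaledIndex m N z)‖ ≤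
      Stirling.stirlingSeq 1 / Real.pi * Real.sqrt (2 / (1 - (m + δ) ^ 2)) / 2 * C *
        ((1 + 2 / c) * Real.exp (2 * c)) * Real.exp (-(c / 4) * z ^ 2) := by
  have hN' : (0 : ℝ) < N := by exact_mod_cast hN
  have hpi := Real.pi_pos
  have hst := stirlingSeq_pos one_ne_zero
  set k := rescaledIndex m N z with hk
  set t := gridPoint N k with ht
  unfold windowTerm
  split_ifs with hw
  swap
  · rw [mul_zero, norm_zero]
    positivity
  have hw' := abs_le.mp hw
  -- Index $0$ corresponds to mean spin $-1$, outside the window; hence the argument of the floor is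
  -- nonnegative and rounding moves it by at most $1$.
  have hk0 : k ≠ 0 := by
    intro h
    rw [h, gridPoint_zero hN] at hw'
    linarith [hw'.1]
  have hy : 0 ≤ N * (1 + m) / 2 + Real.sqrt N / 2 * z := by
    by_contra! hneg
    exact hk0 (Nat.floor_of_nonpos hneg.le)
  have hvz : |Real.sqrt N * (t - m) - z| ≤ 2 := by
    refine (abs_sqrt_mul_gridPoint_sub_le hN hy).trans ?_
    have : 1 ≤ Real.sqrt N := Real.one_le_sqrt.mpr (by exact_mod_cast hN)
    rw [div_le_iff₀ (by positivity)]
    linarith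
  have hv : (N : ℝ) * (t - m) ^ 2 = (Real.sqrt N * (t - m)) ^ 2 := by
    rw [mul_pow, Real.sq_sqrt hN'.le]
  have hb : Real.sqrt N * entropicBinomial N k ≤
      Stirling.stirlingSeq 1 / Real.pi * Real.sqrt (2 / (1 - (m + δ) ^ 2)) :=
    sqrt_mul_entropicBinomial_le hN h1 (abs_le.mpr ⟨by linarith, by linarith⟩)
  have he : Real.exp (N * (freeEnergy p β t - freeEnergy p β m)) ≤
      Real.exp (-c * (Real.sqrt N * (t - m)) ^ 2) := by
    rw [← hv]
    refine Real.exp_le_exp.mpr ((mul_le_mul_of_nonneg_left (hquad t hw) hN'.le).trans_eq ?_)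
    ring
  have hf := hC N t hw
  rw [hv] at hf
  have hexp := one_add_sq_mul_exp_le hc hvz
  set v := Real.sqrt N * (t - m)
  set K := Stirling.stirlingSeq 1 / Real.pi * Real.sqrt (2 / (1 - (m + δ) ^ 2))
  have hb0 : 0 ≤ Real.sqrt N * entropicBinomial N k :=
    mul_nonneg (Real.sqrt_nonneg _) (entropicBinomial_nonneg _ _)
  rw [norm_mul, norm_mul, Real.norm_of_nonneg (by positivity),
    Real.norm_of_nonneg (weight_nonneg ..), Real.norm_eq_abs]
  calc Real.sqrt N / 2 * (weight p β m N k * |f N t|)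
      = Real.sqrt N * entropicBinomial N k / 2 *
          Real.exp (N * (freeEnergy p β t - freeEnergy p β m)) * |f N t| := by
        unfold weight; ring
    _ ≤ K / 2 * Real.exp (-c * v ^ 2) * (C * (1 + v ^ 2)) := by gcongr
    _ = K / 2 * C * ((1 + v ^ 2) * Real.exp (-c * v ^ 2)) := by ring
    _ ≤ K / 2 * C * ((1 + 2 / c) * Real.exp (2 * c) * Real.exp (-(c / 4) * z ^ 2)) := by
        gcongr
    _ = _ := by ring

lemma IsPeak.tendsto_windowTerm (h : IsPeak p β m) (hp : 2 ≤ p) (hδ : 0 < δ)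
    (hf : ∀ (t : ℕ → ℝ) (z : ℝ), Tendsto (fun N : ℕ => Real.sqrt N * (t N - m)) atTop (𝓝 z) →
      Tendsto (fun N => f N (t N)) atTop (𝓝 (φ z))) (z : ℝ) :
    Tendsto (fun N : ℕ => Real.sqrt N / 2 * windowTerm p β m δ f N (rescaledIndex m N z)) atTop
      (𝓝 (1 / Real.sqrt Real.pi * Real.sqrt (2 / (1 - m ^ 2)) / 2 *
        (Real.exp (-(slope p m / m / 2) * z ^ 2) * φ z))) := by
  have hv := tendsto_sqrt_mul_gridPoint_sub (m := m) (by linarith [h.pos]) z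
  have ht := tendsto_of_tendsto_sqrt_mul hv
  have h1 := (tendsto_sqrt_mul_entropicBinomial h.mem_Ioo ht).div_const 2
  have h2 := (Real.continuous_exp.tendsto _).comp (h.tendsto_mul_freeEnergy hp hv ht)
  have h3 := h1.mul (h2.mul (hf _ z hv))
  refine h3.congr' ?_
  have hball : ∀ᶠ N in atTop, |gridPoint N (rescaledIndex m N z) - m| ≤ δ := by
    filter_upwards [ht.eventually (Metric.closedBall_mem_nhds m hδ)] with N hN
    rwa [Real.dist_eq] at hN
  filter_upwards [hball] with N hN
  unfold windowTerm weight
  rw [if_pos hN]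
  simp only [Function.comp_apply]
  ring

lemma IsPeak.tendsto_sum_windowTerm (h : IsPeak p β m) (hp : 2 ≤ p) (hδ : 0 < δ)
    (h1 : m + δ < 1) (h0 : 0 < m - δ)
    (hquad : ∀ t, |t - m| ≤ δ →
      freeEnergy p β t - freeEnergy p β m ≤ -(slope p m / m / 4) * (t - m) ^ 2)
    (hC : ∀ N t, |t - m| ≤ δ → |f N t| ≤ C * (1 + N * (t - m) ^ 2))
    (hf : ∀ (t : ℕ → ℝ) (z : ℝ), Tendsto (fun N : ℕ => Real.sqrt N * (t N - m)) atTop (𝓝 z) →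
      Tendsto (fun N => f N (t N)) atTop (𝓝 (φ z))) :
    Tendsto (fun N : ℕ => ∑ k ∈ Finset.range (N + 1), windowTerm p β m δ f N k) atTop
      (𝓝 (1 / Real.sqrt Real.pi * Real.sqrt (2 / (1 - m ^ 2)) / 2 *
        ∫ z, Real.exp (-(slope p m / m / 2) * z ^ 2) * φ z)) := by
  have hc : 0 < slope p m / m / 4 := by have := h.curvature_pos; positivity
  have hC0 : 0 ≤ C := by
    -- At $N=0$, $t=m$ the growth bound reads $|f|\le C$.
    have := (abs_nonneg _).trans (hC 0 m (by simpa using hδ.le))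
    simpa using this
  rw [← integral_const_mul]
  have key := tendsto_integral_filter_of_dominated_convergence (μ := volume) (l := atTop)
    (F := fun (N : ℕ) z => Real.sqrt N / 2 * windowTerm p β m δ f N (rescaledIndex m N z))
    (fun z => Stirling.stirlingSeq 1 / Real.pi * Real.sqrt (2 / (1 - (m + δ) ^ 2)) / 2 * C *
        ((1 + 2 / (slope p m / m / 4)) * Real.exp (2 * (slope p m / m / 4))) *
        Real.exp (-(slope p m / m / 4 / 4) * z ^ 2))
    (Eventually.of_forall fun N => ?_)
    ((eventually_gt_atTop 0).mono fun N hN => Eventually.of_forall fun z =>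
      norm_windowTerm_le h1 h0 hc hquad hC0 hC hN z)
    ((integrable_exp_neg_mul_sq (by positivity)).const_mul _)
    (Eventually.of_forall fun z => h.tendsto_windowTerm hp hδ hf z)
  · refine key.congr' ?_
    filter_upwards [eventually_gt_atTop 0] with N hN
    have hN' : (0 : ℝ) < N := by exact_mod_cast hN
    refine (sum_range_eq_integral_floor_affine (φ := windowTerm p β m δ f N) ?_ ?_ _
      (by positivity)).symm
    · unfold windowTerm
      rw [if_neg]
      rw [gridPoint_zero hN, abs_le]
      intro hh
      linarith [hh.1]
    · intro k hk
      unfold windowTerm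
      rw [if_neg]
      intro hh
      have hh' := abs_le.mp hh
      have := pos_and_lt_of_gridPoint (k := k) hN ⟨by linarith [hh'.1], by linarith [hh'.2]⟩
      omega
  · refine Measurable.aestronglyMeasurable (Measurable.const_mul ?_ _)
    exact (measurable_from_nat (f := windowTerm p β m δ f N)).comp
      (Nat.measurable_floor.comp (by fun_prop))

end Window

/-! ### Gibbs sums over all magnetizations -/

lemma weight_symm {p : ℕ} (hp : Even p) (β m : ℝ) {N k : ℕ} (hk : k ≤ N) :
    weight p β m N (N - k) = weight p β m N k := by
  unfold weight entropicBinomial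
  rw [gridPoint_sub hk, entropy_neg, freeEnergy_neg hp, Nat.choose_symm hk]

/-- The entropy introduced through Stirling cancels against the one in $g$. The last factor does not
depend on $k$, so it drops out of normalized averages. -/
lemma weight_eq (p : ℕ) (β m : ℝ) (N k : ℕ) :
    weight p β m N k = N.choose k * Real.exp (β * (N * gridPoint N k ^ p)) *
      (1 / 2 ^ N * Real.exp (-(N * freeEnergy p β m))) := by
  have : N.choose k * Real.exp (β * (N * gridPoint N k ^ p)) *
      (1 / 2 ^ N * Real.exp (-(N * freeEnergy p β m))) = N.choose k / 2 ^ N *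
      (Real.exp (β * (N * gridPoint N k ^ p)) * Real.exp (-(N * freeEnergy p β m))) := by ring
  rw [this]
  unfold weight entropicBinomial
  rw [mul_assoc, ← Real.exp_add, ← Real.exp_add]
  congr 2
  unfold freeEnergy
  ring

/-- The unnormalized Curie-Weiss average of a function of the mean spin. -/
noncomputable def gibbsSum (p : ℕ) (β m : ℝ) (N : ℕ) (F : ℝ → ℝ) : ℝ :=
  ∑ k ∈ Finset.range (N + 1), weight p β m N k * F (gridPoint N k)

lemma tendsto_sq_mul_exp_neg {ε : ℝ} (hε : 0 < ε) :
    Tendsto (fun N : ℕ => ((N : ℝ) + 1) ^ 2 * Real.exp (-(N * ε))) atTop (𝓝 0) := by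
  have h := tendsto_pow_const_mul_const_pow_of_abs_lt_one 2 (r := Real.exp (-ε))
    (by rw [abs_of_pos (Real.exp_pos _)]; exact Real.exp_lt_one_iff.mpr (by linarith))
  have h2 := ((tendsto_add_atTop_iff_nat 1).mpr h).mul_const (Real.exp ε)
  rw [zero_mul] at h2
  refine h2.congr fun N => ?_
  rw [← Real.exp_nat_mul, mul_assoc, ← Real.exp_add]
  push_cast
  congr 2
  ring

section Peak

variable {p : ℕ} {β m C : ℝ} {f : ℕ → ℝ → ℝ} {φ : ℝ → ℝ}

/-- For even $p$ the reflection $k\mapsto N-k$ carries the window at $m$ to the one at $-m$ with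
equal contributions, whence the factor $2$. Each of the remaining $N+1$ terms is at most a constant
times $(1+N)e^{-N\varepsilon}$. -/
lemma abs_gibbsSum_sub_le {δ ε : ℝ} (h0 : 0 < m - δ)
    (hgap : ∀ t ∈ Icc (-1 : ℝ) 1, δ ≤ |t - m| → (Even p → δ ≤ |-t - m|) →
      freeEnergy p β t ≤ freeEnergy p β m - ε)
    (hbound : ∀ N, ∀ t ∈ Icc (-1 : ℝ) 1, |f N t| ≤ C * (1 + N))
    (hsymm : Even p → ∀ N t, f N (-t) = f N t) {N : ℕ} (hN : 0 < N) :
    |gibbsSum p β m N (f N) - (if Even p then 2 else 1) *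
        ∑ k ∈ Finset.range (N + 1), windowTerm p β m δ f N k| ≤
      (1 + Stirling.stirlingSeq 1 / Real.pi) * C *
        (((N : ℝ) + 1) ^ 2 * Real.exp (-(N * ε))) := by
  classical
  have hst := stirlingSeq_pos one_ne_zero
  have hpi := Real.pi_pos
  have hflip : ∑ k ∈ Finset.range (N + 1), (if Even p then windowTerm p β m δ f N (N - k) else 0) =
      if Even p then ∑ k ∈ Finset.range (N + 1), windowTerm p β m δ f N k else 0 := by
    split_ifs
    · exact Finset.sum_flip _
    · simp
  have hq : (if Even p then (2 : ℝ) else 1) *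
        ∑ k ∈ Finset.range (N + 1), windowTerm p β m δ f N k =
      ∑ k ∈ Finset.range (N + 1), (windowTerm p β m δ f N k +
        (if Even p then windowTerm p β m δ f N (N - k) else 0)) := by
    rw [Finset.sum_add_distrib, hflip]
    split_ifs <;> ring
  rw [hq, gibbsSum, ← Finset.sum_sub_distrib]
  have hterm : ∀ k ∈ Finset.range (N + 1),
      |weight p β m N k * f N (gridPoint N k) - (windowTerm p β m δ f N k +
        (if Even p then windowTerm p β m δ f N (N - k) else 0))| ≤
      (1 + Stirling.stirlingSeq 1 / Real.pi) * Real.exp (-(N * ε)) * (C * (1 + N)) := by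
    intro k hk
    have hkN : k ≤ N := Nat.lt_succ_iff.mp (Finset.mem_range.mp hk)
    have ht := gridPoint_mem_Icc hN hkN
    have hCN : 0 ≤ C * (1 + N) := (abs_nonneg _).trans (hbound N _ ht)
    have hR : 0 ≤ (1 + Stirling.stirlingSeq 1 / Real.pi) * Real.exp (-(N * ε)) * (C * (1 + N)) := by
      positivity
    unfold windowTerm
    rw [gridPoint_sub hkN]
    set t := gridPoint N k
    by_cases h1 : |t - m| ≤ δ
    · have h2 : ¬ |-t - m| ≤ δ := by
        rw [abs_le] at h1 ⊢
        intro h2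
        linarith [h1.1, h2.1]
      simp only [h1, h2, if_true, if_false, ite_self, add_zero, sub_self, abs_zero]
      exact hR
    · by_cases h2 : Even p ∧ |-t - m| ≤ δ
      · simp only [h1, h2.1, h2.2, if_true, if_false, zero_add, weight_symm h2.1 β m hkN,
          hsymm h2.1, sub_self, abs_zero]
        exact hR
      · have h3 : (if Even p then if |-t - m| ≤ δ then weight p β m N (N - k) * f N (-t) else 0
            else 0) = 0 := by
          split_ifs with h4 h5
          · exact absurd ⟨h4, h5⟩ h2
          · rfl
          · rfl
        rw [if_neg h1, h3, add_zero, sub_zero, abs_mul, abs_of_nonneg (weight_nonneg ..)]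
        have hg := hgap t ht (not_le.mp h1).le
          (fun he => (not_le.mp fun h5 => h2 ⟨he, h5⟩).le)
        have hw : weight p β m N k ≤ (1 + Stirling.stirlingSeq 1 / Real.pi) *
            Real.exp (-(N * ε)) := by
          unfold weight
          refine mul_le_mul (entropicBinomial_le hN hkN) (Real.exp_le_exp.mpr ?_)
            (Real.exp_pos _).le (by positivity)
          have := mul_le_mul_of_nonneg_left (show freeEnergy p β t - freeEnergy p β m ≤ -ε by
            linarith) (Nat.cast_nonneg (α := ℝ) N)
          linarith
        exact mul_le_mul hw (hbound N t ht) (abs_nonneg _) (by positivity)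
  refine (Finset.abs_sum_le_sum_abs _ _).trans ((Finset.sum_le_sum hterm).trans_eq ?_)
  rw [Finset.sum_const, Finset.card_range, nsmul_eq_mul]
  push_cast
  ring

lemma IsPeak.tendsto_gibbsSum (h : IsPeak p β m) (hp : 2 ≤ p) (hβ : 0 ≤ β)
    (hC : ∀ N, ∀ t ∈ Icc (0 : ℝ) 1, |f N t| ≤ C * (1 + N * (t - m) ^ 2))
    (hbound : ∀ N, ∀ t ∈ Icc (-1 : ℝ) 1, |f N t| ≤ C * (1 + N))
    (hsymm : Even p → ∀ N t, f N (-t) = f N t)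
    (hf : ∀ (t : ℕ → ℝ) (z : ℝ), Tendsto (fun N : ℕ => Real.sqrt N * (t N - m)) atTop (𝓝 z) →
      Tendsto (fun N => f N (t N)) atTop (𝓝 (φ z))) :
    Tendsto (fun N => gibbsSum p β m N (f N)) atTop
      (𝓝 ((if Even p then 2 else 1) * (1 / Real.sqrt Real.pi * Real.sqrt (2 / (1 - m ^ 2)) / 2 *
        ∫ z, Real.exp (-(slope p m / m / 2) * z ^ 2) * φ z))) := by
  obtain ⟨δ, hδ, h0, h1, hquad⟩ := h.exists_window hp
  obtain ⟨ε, hε, hgap⟩ := h.exists_gap hp hβ hδ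
  have hC' : ∀ N t, |t - m| ≤ δ → |f N t| ≤ C * (1 + N * (t - m) ^ 2) := fun N t ht => by
    have := abs_le.mp ht
    exact hC N t ⟨by linarith, by linarith⟩
  have hwin := (h.tendsto_sum_windowTerm hp hδ h1 h0 hquad hC' hf).const_mul
    (if Even p then (2 : ℝ) else 1)
  have hrest : Tendsto (fun N => gibbsSum p β m N (f N) - (if Even p then 2 else 1) *
      ∑ k ∈ Finset.range (N + 1), windowTerm p β m δ f N k) atTop (𝓝 0) := by
    have hz := (tendsto_sq_mul_exp_neg hε).const_mul
      ((1 + Stirling.stirlingSeq 1 / Real.pi) * C)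
    rw [mul_zero] at hz
    refine squeeze_zero_norm' ?_ hz
    filter_upwards [eventually_gt_atTop 0] with N hN
    exact abs_gibbsSum_sub_le h0 hgap hbound hsymm hN
  have := hrest.add hwin
  rw [zero_add] at this
  exact this.congr fun N => sub_add_cancel _ _

lemma integral_gaussianReal_zero_eq {c : ℝ} (hc : 0 < c) (φ : ℝ → ℝ) :
    ∫ z, φ z ∂(gaussianReal 0 (Real.toNNReal (1 / c))) =
      (∫ z, Real.exp (-(c / 2) * z ^ 2) * φ z) / ∫ z, Real.exp (-(c / 2) * z ^ 2) := by
  have hv : Real.toNNReal (1 / c) ≠ 0 := by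
    rw [ne_eq, Real.toNNReal_eq_zero, not_le]; positivity
  have hs : 0 < Real.sqrt (Real.pi / (c / 2)) := by have := Real.pi_pos; positivity
  rw [integral_gaussianReal_eq_integral_smul hv, integral_gaussian, eq_div_iff hs.ne',
    ← integral_mul_const]
  refine integral_congr_ae (Eventually.of_forall fun z => ?_)
  simp only [gaussianPDFReal, smul_eq_mul, sub_zero]
  rw [Real.coe_toNNReal _ (by positivity),
    show 2 * Real.pi * (1 / c) = Real.pi / (c / 2) by field_simp,
    show -z ^ 2 / (2 * (1 / c)) = -(c / 2) * z ^ 2 by field_simp]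
  field_simp

/-- The rescaled mean spin is asymptotically Gaussian near the peaks, in integrated form. -/
theorem IsPeak.tendsto_gibbsAverage (h : IsPeak p β m) (hp : 2 ≤ p) (hβ : 0 ≤ β)
    (hC : ∀ N, ∀ t ∈ Icc (0 : ℝ) 1, |f N t| ≤ C * (1 + N * (t - m) ^ 2))
    (hbound : ∀ N, ∀ t ∈ Icc (-1 : ℝ) 1, |f N t| ≤ C * (1 + N))
    (hsymm : Even p → ∀ N t, f N (-t) = f N t)
    (hf : ∀ (t : ℕ → ℝ) (z : ℝ), Tendsto (fun N : ℕ => Real.sqrt N * (t N - m)) atTop (𝓝 z) →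
      Tendsto (fun N => f N (t N)) atTop (𝓝 (φ z))) :
    Tendsto (fun N => gibbsSum p β m N (f N) / gibbsSum p β m N (fun _ => 1)) atTop
      (𝓝 (∫ z, φ z ∂(gaussianReal 0 (Real.toNNReal (1 / (slope p m / m)))))) := by
  have hc := h.curvature_pos
  have hnum := h.tendsto_gibbsSum hp hβ hC hbound hsymm hf
  have hden := h.tendsto_gibbsSum (f := fun _ _ => 1) (φ := fun _ => 1) (C := 1) hp hβ
    (fun N t _ => by
      have : (0 : ℝ) ≤ N * (t - m) ^ 2 := by positivity
      simpa using this)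
    (fun N t _ => by simp)
    (fun _ _ _ => rfl) (fun _ _ _ => tendsto_const_nhds)
  have hq : (0 : ℝ) < if Even p then 2 else 1 := by split_ifs <;> norm_num
  have hm := one_sub_sq_pos h.mem_Ioo
  have hpi := Real.pi_pos
  have hκ : 0 < 1 / Real.sqrt Real.pi * Real.sqrt (2 / (1 - m ^ 2)) / 2 := by positivity
  simp only [mul_one] at hden
  have hint : 0 < ∫ z, Real.exp (-(slope p m / m / 2) * z ^ 2) := by
    rw [integral_gaussian]; positivity
  rw [integral_gaussianReal_zero_eq hc]
  have := hnum.div hden (by positivity)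
  -- The number of peaks and Stirling's prefactor at $m$ are common to numerator and denominator.
  rwa [mul_div_mul_left _ _ hq.ne', mul_div_mul_left _ _ hκ.ne'] at this

end Peak

/-! ### Reduction of the Curie-Weiss model to the mean spin -/

/-- The average `N⁻¹ ∑ x_i` of the spins. -/
noncomputable def meanSpin {N : ℕ} (x : Config N) : ℝ := (∑ i, spin x i) / N

lemma spin_eq_ite {N : ℕ} (x : Config N) (i : Fin N) : spin x i = if x i = 1 then 1 else -1 := by
  unfold spin
  rcases Int.units_eq_one_or (x i) with h | h
  · simp [h]
  · rw [h, if_neg (by decide)]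
    simp

lemma sum_spin_eq {N : ℕ} (x : Config N) :
    ∑ i, spin x i = 2 * ((Finset.univ.filter fun i => x i = 1).card : ℝ) - N := by
  simp_rw [spin_eq_ite]
  have h : ∀ i, (if x i = 1 then (1 : ℝ) else -1) = 2 * (if x i = 1 then 1 else 0) - 1 := by
    intro i
    split_ifs <;> norm_num
  simp_rw [h]
  rw [Finset.sum_sub_distrib, ← Finset.mul_sum, Finset.sum_boole]
  simp

lemma meanSpin_eq {N : ℕ} (x : Config N) :
    meanSpin x = gridPoint N (Finset.univ.filter fun i => x i = 1).card := by
  rw [meanSpin, sum_spin_eq, gridPoint]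

/-- A configuration is the set of its positive spins; grouping these sets by cardinality produces
the binomial coefficients. -/
lemma sum_config_eq {N : ℕ} (F : ℝ → ℝ) :
    ∑ x : Config N, F (meanSpin x) =
      ∑ k ∈ Finset.range (N + 1), (N.choose k : ℝ) * F (gridPoint N k) := by
  classical
  have h := Finset.sum_powerset_apply_card (fun k => F (gridPoint N k))
    (x := (Finset.univ : Finset (Fin N)))
  rw [Finset.card_univ, Fintype.card_fin] at h
  simp only [nsmul_eq_mul] at h
  rw [← h]
  refine Finset.sum_bij' (fun x _ => Finset.univ.filter fun i => x i = 1)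
    (fun s _ i => if i ∈ s then 1 else -1) (fun _ _ => by simp) (fun _ _ => Finset.mem_univ _)
    ?_ ?_ ?_
  · intro x _
    funext i
    simp only [Finset.mem_filter, Finset.mem_univ, true_and]
    split_ifs with hi
    · exact hi.symm
    · exact ((Int.units_eq_one_or (x i)).resolve_left hi).symm
  · intro s _
    ext i
    simp only [Finset.mem_filter, Finset.mem_univ, true_and]
    by_cases hi : i ∈ s
    · simp [hi]
    · simp only [hi, if_false, iff_false]
      decide
  · intro x _
    rw [meanSpin_eq]

section CurieWeiss

variable {p N : ℕ}

lemma localField_curieWeiss (x : Config N) (i : Fin N) :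
    localField (curieWeissTensor p N) x i = meanSpin x ^ (p - 1) := by
  unfold localField curieWeissTensor meanSpin
  rw [← Finset.mul_sum, div_pow, Finset.sum_pow' Finset.univ (fun i => spin x i) (p - 1),
    Fintype.piFinset_univ]
  ring

lemma hamiltonian_eq_sum (J : Tensor p N) (x : Config N) :
    hamiltonian J x = ∑ i, spin x i * localField J x i := by
  unfold hamiltonian localField
  refine Finset.sum_congr rfl fun i _ => ?_
  rw [Finset.mul_sum]
  refine Finset.sum_congr rfl fun k _ => ?_
  ring

lemma hamiltonian_curieWeiss (hp : 1 ≤ p) (hN : 0 < N) (x : Config N) :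
    hamiltonian (curieWeissTensor p N) x = N * meanSpin x ^ p := by
  have hN' : (N : ℝ) ≠ 0 := by exact_mod_cast hN.ne'
  rw [hamiltonian_eq_sum]
  simp_rw [localField_curieWeiss]
  rw [← Finset.sum_mul]
  have h : ∑ i, spin x i = N * meanSpin x := by
    unfold meanSpin
    field_simp
  rw [h, mul_assoc, ← pow_succ', Nat.sub_add_cancel hp]

-- Makes every function on the finite configuration space measurable, so integrals against the Dirac
-- sum are plain sums.
instance : MeasurableSingletonClass ℤˣ where
  measurableSet_singleton u :=
    ⟨{(u : ℤ)}, MeasurableSet.of_discrete, by ext v; simp [Units.ext_iff]⟩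

lemma integral_law (J : Tensor p N) (β : ℝ) (F : Config N → ℝ) :
    ∫ x, F x ∂(law J β) = ∑ x, massFunction J β x * F x := by
  unfold law
  rw [integral_finsetSum_measure fun x _ =>
    (integrable_dirac (by simp)).smul_measure ENNReal.ofReal_ne_top]
  refine Finset.sum_congr rfl fun x _ => ?_
  rw [integral_smul_measure, integral_dirac, ENNReal.toReal_ofReal (massFunction_nonneg J β x),
    smul_eq_mul]

lemma massFunction_eq (J : Tensor p N) (β : ℝ) (x : Config N) :
    massFunction J β x =
      Real.exp (β * hamiltonian J x) / ∑ y, Real.exp (β * hamiltonian J y) := by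
  unfold massFunction partitionFunction
  rw [← mul_assoc, mul_one_div_cancel (by positivity), one_mul]

lemma sum_exp_hamiltonian_mul (hp : 1 ≤ p) (hN : 0 < N) (β m : ℝ) (F : ℝ → ℝ) :
    (∑ x : Config N, Real.exp (β * hamiltonian (curieWeissTensor p N) x) * F (meanSpin x)) *
      (1 / 2 ^ N * Real.exp (-(N * freeEnergy p β m))) = gibbsSum p β m N F := by
  simp_rw [hamiltonian_curieWeiss hp hN]
  rw [sum_config_eq (fun t => Real.exp (β * (N * t ^ p)) * F t), Finset.sum_mul]
  unfold gibbsSum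
  refine Finset.sum_congr rfl fun k _ => ?_
  rw [weight_eq]
  ring

/-- Expectations of functions of the mean spin as ratios of binomial sums. -/
lemma integral_law_curieWeiss (hp : 1 ≤ p) (hN : 0 < N) (β m : ℝ) (F : ℝ → ℝ) :
    ∫ x, F (meanSpin x) ∂(law (curieWeissTensor p N) β) =
      gibbsSum p β m N F / gibbsSum p β m N (fun _ => 1) := by
  rw [integral_law, ← sum_exp_hamiltonian_mul hp hN, ← sum_exp_hamiltonian_mul hp hN,
    mul_div_mul_right _ _ (by positivity), Finset.sum_div]
  refine Finset.sum_congr rfl fun x _ => ?_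
  rw [massFunction_eq]
  simp only [mul_one]
  ring

/-- The maximum pseudo-likelihood estimate as a function of the mean spin. -/
noncomputable def mpleOfMean (p : ℕ) (t : ℝ) : EReal :=
  sInf ((fun b : ℝ => (b : EReal)) '' {b : ℝ | 0 ≤ b ∧
    t ^ p = t ^ (p - 1) * Real.tanh (p * b * t ^ (p - 1))})

lemma mple_curieWeiss (hp : 1 ≤ p) (hN : 0 < N) (x : Config N) :
    mple (curieWeissTensor p N) x = mpleOfMean p (meanSpin x) := by
  have hN' : (N : ℝ) ≠ 0 := by exact_mod_cast hN.ne'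
  unfold mple mpleOfMean
  simp_rw [hamiltonian_curieWeiss hp hN, localField_curieWeiss, Finset.sum_const,
    Finset.card_univ, Fintype.card_fin, nsmul_eq_mul, mul_right_inj' hN']

lemma mpleOfMean_neg (hp : 1 ≤ p) (hev : Even p) (t : ℝ) : mpleOfMean p (-t) = mpleOfMean p t := by
  have hodd : Odd (p - 1) := Nat.Even.sub_odd hp hev odd_one
  unfold mpleOfMean
  simp_rw [hev.neg_pow, hodd.neg_pow, mul_neg, Real.tanh_neg, neg_mul_neg]

/-- After cancelling $t^{p-1}>0$ the equation is $t=\tanh(p\,b\,t^{p-1})$, solved uniquely by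
inverting $\tanh$; positivity of $t$ makes the root admissible. -/
lemma mpleOfMean_eq (hp : 1 ≤ p) {t : ℝ} (ht : t ∈ Ioo (0 : ℝ) 1) :
    mpleOfMean p t = ((Real.artanh t / t ^ (p - 1) / p : ℝ) : EReal) := by
  have ht' : t ∈ Ioo (-1 : ℝ) 1 := ⟨by linarith [ht.1], ht.2⟩
  have hpow : 0 < t ^ (p - 1) := pow_pos ht.1 _
  have hp' : (0 : ℝ) < p := by exact_mod_cast hp
  have hset : {b : ℝ | 0 ≤ b ∧ t ^ p = t ^ (p - 1) * Real.tanh (p * b * t ^ (p - 1))} =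
      {Real.artanh t / t ^ (p - 1) / p} := by
    ext b
    simp only [mem_ofPred_eq, mem_singleton_iff]
    have h1 : t ^ p = t ^ (p - 1) * t := by rw [← pow_succ, Nat.sub_add_cancel hp]
    rw [h1, mul_right_inj' hpow.ne']
    constructor
    · rintro ⟨-, hb⟩
      rw [hb, Real.artanh_tanh, ← hb]
      field_simp
    · rintro rfl
      refine ⟨div_nonneg (div_nonneg (Real.artanh_nonneg ht.1.le) hpow.le) hp'.le, ?_⟩
      rw [show (p : ℝ) * (Real.artanh t / t ^ (p - 1) / p) * t ^ (p - 1) = Real.artanh t by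
        field_simp, Real.tanh_artanh ht']
  unfold mpleOfMean
  rw [hset, image_singleton, sInf_singleton]

/-- The score is $H-\mathbb E H$, so the information is a variance, and a variance may be computed
around any centre $a$. Choosing $a=Nm^p$ later replaces the unknown mean by the peak value. -/
lemma fisherInformation_eq (J : Tensor p N) (β a : ℝ) :
    fisherInformation J β = 1 / (N : ℝ) * (∫ x, (hamiltonian J x - a) ^ 2 ∂(law J β) -
      (∫ x, (hamiltonian J x - a) ∂(law J β)) ^ 2) := by
  have hZ : ∀ b : ℝ, 0 < ∑ y, Real.exp (b * hamiltonian J y) := fun b =>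
    Finset.sum_pos (fun x _ => Real.exp_pos _) Finset.univ_nonempty
  have hderiv : ∀ x, deriv (fun b => Real.log (massFunction J b x)) β =
      hamiltonian J x - ∑ y, massFunction J β y * hamiltonian J y := by
    intro x
    have h1 : (fun b => Real.log (massFunction J b x)) = fun b =>
        b * hamiltonian J x - Real.log (∑ y, Real.exp (b * hamiltonian J y)) := by
      funext b
      rw [massFunction_eq, Real.log_div (Real.exp_pos _).ne' (hZ b).ne', Real.log_exp]
    have h2 : HasDerivAt (fun b => ∑ y, Real.exp (b * hamiltonian J y))
        (∑ y, Real.exp (β * hamiltonian J y) * hamiltonian J y) β := by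
      refine HasDerivAt.fun_sum fun y _ => ?_
      exact (hasDerivAt_mul_const _).exp
    rw [h1, ((hasDerivAt_mul_const (hamiltonian J x)).fun_sub (h2.log (hZ β).ne')).deriv,
      Finset.sum_div]
    congr 1
    refine Finset.sum_congr rfl fun y _ => ?_
    rw [massFunction_eq]
    ring
  unfold fisherInformation
  simp_rw [hderiv, integral_law]
  congr 1
  set M := ∑ y, massFunction J β y * hamiltonian J y
  have h0 := sum_massFunction J β
  have hexp : ∀ d : ℝ, ∑ x, massFunction J β x * (hamiltonian J x - d) ^ 2 =
      ∑ x, massFunction J β x * hamiltonian J x ^ 2 - 2 * d * M + d ^ 2 := by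
    intro d
    have : ∀ x, massFunction J β x * (hamiltonian J x - d) ^ 2 =
        massFunction J β x * hamiltonian J x ^ 2 -
          2 * d * (massFunction J β x * hamiltonian J x) + d ^ 2 * massFunction J β x := fun x => by
      ring
    simp_rw [this]
    rw [Finset.sum_add_distrib, Finset.sum_sub_distrib, ← Finset.mul_sum, ← Finset.mul_sum, h0,
      mul_one]
  have hlin : ∑ x, massFunction J β x * (hamiltonian J x - a) = M - a := by
    simp_rw [mul_sub]
    rw [Finset.sum_sub_distrib, ← Finset.sum_mul, h0, one_mul]
  rw [hexp, hexp, hlin]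
  ring

end CurieWeiss

/-! ### Delta method and the two limits -/

/-- The delta method for deterministic sequences. -/
lemma tendsto_sqrt_mul_sub_of_hasDerivAt {u : ℝ → ℝ} {u' m z : ℝ} (hu : HasDerivAt u u' m)
    {t : ℕ → ℝ} (ht : Tendsto (fun N : ℕ => Real.sqrt N * (t N - m)) atTop (𝓝 z)) :
    Tendsto (fun N : ℕ => Real.sqrt N * (u (t N) - u m)) atTop (𝓝 (u' * z)) := by
  have h1 := (hasDerivAt_iff_isLittleO.mp hu).comp_tendsto (tendsto_of_tendsto_sqrt_mul ht)
  have h2 : (fun N : ℕ => Real.sqrt N * (u (t N) - u m - (t N - m) • u')) =o[atTop]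
      fun N : ℕ => Real.sqrt N * (t N - m) :=
    (Asymptotics.isBigO_refl _ _).mul_isLittleO h1
  have h3 := (h2.trans_isBigO (ht.isBigO_one ℝ)).tendsto_zero_of_tendsto tendsto_const_nhds |>.add
    (ht.const_mul u')
  rw [zero_add] at h3
  refine h3.congr fun N => ?_
  simp only [smul_eq_mul]
  ring

namespace IsPeak

variable {p : ℕ} {β m : ℝ}

/-- First and second moments of $\sqrt N(t^p-m^p)$ converge to those of the Gaussian $p\,m^{p-1}z$.
These observables are unbounded in $N$, which is why the Laplace theorem admits growth $1+N(t-m)^2$.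
-/
lemma tendsto_fisherInformation (h : IsPeak p β m) (hp : 2 ≤ p) (hβ : 0 ≤ β) :
    Tendsto (fun N : ℕ => fisherInformation (curieWeissTensor p N) β) atTop
      (𝓝 ((p * m ^ (p - 1)) ^ 2 * (1 / (slope p m / m)))) := by
  have hc := h.curvature_pos
  have hp2 : (2 : ℝ) ≤ p := by exact_mod_cast hp
  have hpp : (p : ℝ) ≤ p ^ 2 := by nlinarith
  have hp4 : (4 : ℝ) ≤ p ^ 2 := by nlinarith
  have hm0 := h.pos
  have hm1 := h.lt_one
  have hlip : ∀ t ∈ Icc (0 : ℝ) 1, |t ^ p - m ^ p| ≤ p * |t - m| := by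
    intro t ht
    refine (abs_pow_sub_pow_le t m p).trans ?_
    have hmax : max |t| |m| ≤ 1 :=
      max_le (abs_le.mpr ⟨by linarith [ht.1], ht.2⟩) (abs_le.mpr ⟨by linarith, hm1.le⟩)
    have : max |t| |m| ^ (p - 1) ≤ 1 := pow_le_one₀ (le_max_of_le_left (abs_nonneg t)) hmax
    calc |t - m| * p * max |t| |m| ^ (p - 1) ≤ |t - m| * p * 1 := by gcongr
      _ = p * |t - m| := by ring
  have htwo : ∀ t ∈ Icc (-1 : ℝ) 1, |t ^ p - m ^ p| ≤ 2 := by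
    intro t ht
    have h1 : |t ^ p| ≤ 1 := by
      rw [abs_pow]; exact pow_le_one₀ (abs_nonneg t) (abs_le.mpr ht)
    have h2 : |m ^ p| ≤ 1 := by
      rw [abs_pow]; exact pow_le_one₀ (abs_nonneg m) (abs_le.mpr ⟨by linarith, hm1.le⟩)
    linarith [abs_sub (t ^ p) (m ^ p)]
  have hdelta : ∀ (t : ℕ → ℝ) (z : ℝ),
      Tendsto (fun N : ℕ => Real.sqrt N * (t N - m)) atTop (𝓝 z) →
      Tendsto (fun N : ℕ => Real.sqrt N * (t N ^ p - m ^ p)) atTop (𝓝 (p * m ^ (p - 1) * z)) :=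
    fun t z ht => tendsto_sqrt_mul_sub_of_hasDerivAt (hasDerivAt_pow p m) ht
  have hsq : ∀ (N : ℕ) (y : ℝ), (N : ℝ) * y ^ 2 = (Real.sqrt N * y) ^ 2 := fun N y => by
    rw [mul_pow, Real.sq_sqrt (Nat.cast_nonneg N)]
  have hself : ∀ y : ℝ, |y| ≤ 1 + y ^ 2 := fun y => by
    rw [← sq_abs]; nlinarith [sq_nonneg (|y| - 1), abs_nonneg y]
  have hsqrt : ∀ N : ℕ, Real.sqrt N * 2 ≤ 1 + N := fun N => by
    nlinarith [sq_nonneg (Real.sqrt N - 1), Real.sq_sqrt (Nat.cast_nonneg (α := ℝ) N)]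
  -- $C=p^2$ serves both bounds: it is the squared Lipschitz constant of $t^p$ on $[0,1]$, and it
  -- dominates $2^2$, the crude bound on $[-1,1]$, since $p\ge 2$.
  have h1 := h.tendsto_gibbsAverage (f := fun N t => N * (t ^ p - m ^ p) ^ 2)
    (φ := fun z => (p * m ^ (p - 1) * z) ^ 2) (C := p ^ 2) hp hβ
    (fun N t ht => by
      have e1 : (t ^ p - m ^ p) ^ 2 ≤ (p * |t - m|) ^ 2 := by
        rw [← sq_abs (t ^ p - m ^ p)]
        exact pow_le_pow_left₀ (abs_nonneg _) (hlip t ht) 2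
      rw [abs_of_nonneg (by positivity)]
      calc (N : ℝ) * (t ^ p - m ^ p) ^ 2 ≤ N * (p * |t - m|) ^ 2 := by gcongr
        _ = p ^ 2 * (N * (t - m) ^ 2) := by rw [mul_pow, sq_abs]; ring
        _ ≤ p ^ 2 * (1 + N * (t - m) ^ 2) := by gcongr; linarith)
    (fun N t ht => by
      have e1 : (t ^ p - m ^ p) ^ 2 ≤ 2 ^ 2 := by
        rw [← sq_abs (t ^ p - m ^ p)]
        exact pow_le_pow_left₀ (abs_nonneg _) (htwo t ht) 2
      rw [abs_of_nonneg (by positivity)]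
      have hN : (0 : ℝ) ≤ N := Nat.cast_nonneg N
      calc (N : ℝ) * (t ^ p - m ^ p) ^ 2 ≤ N * 2 ^ 2 := by gcongr
        _ = 4 * (N : ℝ) := by ring
        _ ≤ (p : ℝ) ^ 2 * (1 + N) := mul_le_mul hp4 (by linarith) hN (by positivity))
    (fun hev N t => by simp only [hev.neg_pow])
    (fun t z ht => by
      simp_rw [hsq]
      exact (hdelta t z ht).pow 2)
  have h2 := h.tendsto_gibbsAverage (f := fun N t => Real.sqrt N * (t ^ p - m ^ p))
    (φ := fun z => p * m ^ (p - 1) * z) (C := p ^ 2) hp hβ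
    (fun N t ht => by
      rw [abs_mul, abs_of_nonneg (Real.sqrt_nonneg _), hsq]
      calc Real.sqrt N * |t ^ p - m ^ p| ≤ Real.sqrt N * (p * |t - m|) := by
            gcongr; exact hlip t ht
        _ = p * |Real.sqrt N * (t - m)| := by
            rw [abs_mul, abs_of_nonneg (Real.sqrt_nonneg _)]; ring
        _ ≤ p ^ 2 * (1 + (Real.sqrt N * (t - m)) ^ 2) :=
            mul_le_mul hpp (hself _) (abs_nonneg _) (by positivity))
    (fun N t ht => by
      rw [abs_mul, abs_of_nonneg (Real.sqrt_nonneg _)]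
      calc Real.sqrt N * |t ^ p - m ^ p| ≤ Real.sqrt N * 2 := by gcongr; exact htwo t ht
        _ ≤ 1 * (1 + N) := by rw [one_mul]; exact hsqrt N
        _ ≤ p ^ 2 * (1 + N) := by gcongr; linarith)
    (fun hev N t => by simp only [hev.neg_pow])
    hdelta
  have hI2 : ∫ z, p * m ^ (p - 1) * z ∂(gaussianReal 0 (Real.toNNReal (1 / (slope p m / m)))) =
      0 := by
    rw [integral_const_mul, integral_id_gaussianReal, mul_zero]
  have hI1 : ∫ z, (p * m ^ (p - 1) * z) ^ 2
      ∂(gaussianReal 0 (Real.toNNReal (1 / (slope p m / m)))) =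
      (p * m ^ (p - 1)) ^ 2 * (1 / (slope p m / m)) := by
    have hv := variance_fun_id_gaussianReal (μ := 0) (v := Real.toNNReal (1 / (slope p m / m)))
    rw [variance_of_integral_eq_zero (by fun_prop) integral_id_gaussianReal,
      Real.coe_toNNReal _ (by positivity)] at hv
    simp_rw [mul_pow _ _ 2]
    rw [integral_const_mul, hv]
  rw [hI1] at h1
  rw [hI2] at h2
  have h3 := h1.sub (h2.pow 2)
  rw [zero_pow two_ne_zero, sub_zero] at h3
  refine h3.congr' ?_
  filter_upwards [eventually_gt_atTop 0] with N hN
  have hN' : (0 : ℝ) < N := by exact_mod_cast hN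
  have hss := Real.mul_self_sqrt hN'.le
  rw [← integral_law_curieWeiss (by omega) hN β m (fun t => N * (t ^ p - m ^ p) ^ 2),
    ← integral_law_curieWeiss (by omega) hN β m (fun t => Real.sqrt N * (t ^ p - m ^ p)),
    fisherInformation_eq _ β (N * m ^ p)]
  have e1 : ∀ x : Config N, (hamiltonian (curieWeissTensor p N) x - N * m ^ p) ^ 2 =
      N * (N * (meanSpin x ^ p - m ^ p) ^ 2) := fun x => by
    rw [hamiltonian_curieWeiss (by omega) hN]; ring
  have e2 : ∀ x : Config N, hamiltonian (curieWeissTensor p N) x - N * m ^ p =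
      Real.sqrt N * (Real.sqrt N * (meanSpin x ^ p - m ^ p)) := fun x => by
    rw [hamiltonian_curieWeiss (by omega) hN, ← mul_assoc, hss]; ring
  simp_rw [e1, e2]
  have i1 := integral_const_mul (μ := law (curieWeissTensor p N) β) (N : ℝ)
    fun x => (N : ℝ) * (meanSpin x ^ p - m ^ p) ^ 2
  have i2 := integral_const_mul (μ := law (curieWeissTensor p N) β) (Real.sqrt N)
    fun x => Real.sqrt N * (meanSpin x ^ p - m ^ p)
  rw [i1, i2, mul_pow (Real.sqrt N), Real.sq_sqrt hN'.le, ← mul_sub, ← mul_assoc,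
    one_div_mul_cancel hN'.ne', one_mul]

lemma tendsto_rescaled_mpleOfMean (h : IsPeak p β m) (hp : 2 ≤ p) {t : ℕ → ℝ} {z : ℝ}
    (ht : Tendsto (fun N : ℕ => Real.sqrt N * (t N - m)) atTop (𝓝 z)) :
    Tendsto (fun N : ℕ => ((Real.sqrt N : ℝ) : EReal) * (mpleOfMean p (t N) - (β : EReal))) atTop
      (𝓝 ((slope p m / m ^ p / p * z : ℝ) : EReal)) := by
  have hp' : (p : ℝ) ≠ 0 := by positivity
  have hm : m ∈ Ioo (0 : ℝ) 1 := ⟨h.pos, h.lt_one⟩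
  have hu : HasDerivAt (fun t => Real.artanh t / t ^ (p - 1) / p) (slope p m / m ^ p / p) m :=
    (hasDerivAt_artanh_div_pow hp hm).div_const _
  -- Consistency of the estimator: at the peak, the pseudo-likelihood equation is the critical point
  -- equation.
  have hβm : Real.artanh m / m ^ (p - 1) / p = β := by
    have := (pow_pos h.pos (p - 1)).ne'
    rw [← h.critical]
    field_simp
  have h1 := (continuous_coe_real_ereal.tendsto _).comp (tendsto_sqrt_mul_sub_of_hasDerivAt hu ht)
  refine h1.congr' ?_
  filter_upwards [(tendsto_of_tendsto_sqrt_mul ht).eventually (isOpen_Ioo.mem_nhds hm)] with N hN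
  rw [mpleOfMean_eq (by omega) hN]
  simp only [Function.comp_apply, hβm]
  rw [EReal.coe_mul, EReal.coe_sub]

/-- A bounded continuous test function on the extended reals makes the observable bounded, so the
estimator's values away from the peaks, infinite ones included, need no analysis beyond evenness in
$t$ for even $p$. -/
lemma tendstoInDistribution_mple (h : IsPeak p β m) (hp : 2 ≤ p) (hβ : 0 ≤ β) {v : NNReal}
    (hv : (v : ℝ) = (slope p m / m ^ p / p) ^ 2 * (1 / (slope p m / m))) :
    TendstoInDistribution
      (fun (N : ℕ) (x : Config N) =>
        ((Real.sqrt N : ℝ) : EReal) * (mple (curieWeissTensor p N) x - (β : EReal)))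
      atTop (fun z : ℝ => (z : EReal)) (fun N : ℕ => law (curieWeissTensor p N) β)
      (gaussianReal 0 v) where
  forall_aemeasurable N := (measurable_of_finite _).aemeasurable
  aemeasurable_limit := measurable_coe_real_ereal.aemeasurable
  tendsto := by
    refine ProbabilityMeasure.tendsto_iff_forall_integral_tendsto.mpr fun G => ?_
    have hc := h.curvature_pos
    -- The limit law is the Gaussian of the mean spin scaled by the derivative $u'(m)$.
    have hgauss : gaussianReal 0 v = (gaussianReal 0 (Real.toNNReal (1 / (slope p m / m)))).map
        (slope p m / m ^ p / p * ·) := by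
      rw [gaussianReal_map_const_mul, mul_zero]
      congr 1
      ext
      rw [hv, NNReal.coe_mul, Real.coe_toNNReal _ (by positivity), NNReal.coe_mk]
    have hG := h.tendsto_gibbsAverage
      (f := fun N t => G (((Real.sqrt N : ℝ) : EReal) * (mpleOfMean p t - (β : EReal))))
      (φ := fun z => G ((slope p m / m ^ p / p * z : ℝ) : EReal)) (C := ‖G‖) hp hβ
      (fun N t _ => (G.norm_coe_le_norm _).trans
        (le_mul_of_one_le_right (norm_nonneg _) (le_add_of_nonneg_right (by positivity))))
      (fun N t _ => (G.norm_coe_le_norm _).trans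
        (le_mul_of_one_le_right (norm_nonneg _) (le_add_of_nonneg_right (by positivity))))
      (fun hev N t => by simp only [mpleOfMean_neg (by omega : 1 ≤ p) hev])
      (fun t z ht => (G.continuous.tendsto _).comp (h.tendsto_rescaled_mpleOfMean hp ht))
    change Tendsto (fun N : ℕ => ∫ y, G y ∂((law (curieWeissTensor p N) β).map fun x =>
      ((Real.sqrt N : ℝ) : EReal) * (mple (curieWeissTensor p N) x - (β : EReal)))) atTop
      (𝓝 (∫ y, G y ∂((gaussianReal 0 v).map fun z : ℝ => (z : EReal))))
    rw [integral_map measurable_coe_real_ereal.aemeasurable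
      G.continuous.measurable.aestronglyMeasurable, hgauss,
      integral_map (by fun_prop) (by
        exact (G.continuous.comp continuous_coe_real_ereal).aestronglyMeasurable)]
    refine hG.congr' ?_
    filter_upwards [eventually_gt_atTop 0] with N hN
    rw [integral_map (measurable_of_finite _).aemeasurable
      G.continuous.measurable.aestronglyMeasurable,
      ← integral_law_curieWeiss (by omega) hN β m
        (fun t => G (((Real.sqrt N : ℝ) : EReal) * (mpleOfMean p t - (β : EReal))))]
    simp_rw [mple_curieWeiss (show 1 ≤ p by omega) hN]

end IsPeak

end TensorIsing

theorem theorem3p5 (p : ℕ) (hp : 2 ≤ p) (β : ℝ) (hβ : TensorIsing.threshold p < β) :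
    ∃ m : ℝ, 0 < m ∧ m < 1 ∧
      IsMaxOn (TensorIsing.freeEnergy p β) (Icc (-1) 1) m ∧
      (∀ t ∈ Icc (-1 : ℝ) 1, 0 < t →
        IsMaxOn (TensorIsing.freeEnergy p β) (Icc (-1) 1) t → t = m) ∧
      deriv (deriv (TensorIsing.freeEnergy p β)) m < 0 ∧
      TendstoInDistribution
        (fun (N : ℕ) (x : TensorIsing.Config N) =>
          ((Real.sqrt N : ℝ) : EReal) *
            (TensorIsing.mple (TensorIsing.curieWeissTensor p N) x - (β : EReal)))
        atTop
        (fun z : ℝ => (z : EReal))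
        (fun N : ℕ => TensorIsing.law (TensorIsing.curieWeissTensor p N) β)
        (gaussianReal 0 (Real.toNNReal
          (-(deriv (deriv (TensorIsing.freeEnergy p β)) m) /
            ((p : ℝ) ^ 2 * m ^ (2 * p - 2))))) ∧
      Tendsto
        (fun N : ℕ => TensorIsing.fisherInformation (TensorIsing.curieWeissTensor p N) β)
        atTop
        (𝓝 ((-(deriv (deriv (TensorIsing.freeEnergy p β)) m) /
            ((p : ℝ) ^ 2 * m ^ (2 * p - 2)))⁻¹)) := by
  have hβ0 := (TensorIsing.pos_of_threshold_lt hβ).le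
  obtain ⟨m, h⟩ := TensorIsing.exists_isPeak hp hβ
  have hc := h.curvature_pos
  have hm := h.pos
  have hp' : (0 : ℝ) < p := by positivity
  have hvar : (p : ℝ) ^ 2 * m ^ (2 * p - 2) = (p * m ^ (p - 1)) ^ 2 := by
    rw [mul_pow, ← pow_mul]
    congr 2
    omega
  refine ⟨m, h.pos, h.lt_one, h.isMaxOn, h.unique, ?_, ?_, ?_⟩
  · rw [h.deriv_deriv hp]
    linarith
  · refine h.tendstoInDistribution_mple hp hβ0 ?_
    rw [h.deriv_deriv hp, neg_neg, hvar, Real.coe_toNNReal _ (by positivity)]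
    have hs := h.slope_pos
    -- Exposes the common power of $m$ in $u'(m)^2/(-g''(m))$, where one factor of `slope` then
    -- cancels.
    have hmp : m ^ p = m ^ (p - 1) * m := by rw [← pow_succ, Nat.sub_add_cancel (by omega)]
    rw [hmp]
    field_simp
  · rw [h.deriv_deriv hp, neg_neg, hvar, inv_div, div_eq_mul_one_div]
    exact h.tendsto_fisherInformation hp hβ0
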